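/- Let $S$ be a smooth, compact, connected, oriented surface, possibly with boundary, with $\chi(S)<0$, and fix a hyperbolic metric on $S$ with geodesic boundary. It identifies the universal cover $\tilde S$ with a closed convex subset of the hyperbolic plane $\mathbb{H}^2$ bounded by complete geodesics, on which $\pi_1(S)$ acts by orientation-preserving isometries. Let $\partial_\infty\tilde S\subset\partial\mathbb{H}^2$ be the set of points at infinity in the closure of $\tilde S$, and let $\mathcal G(\tilde S)$ be the space of unordered pairs of distinct points of $\partial_\infty\tilde S$. A geodesic current on $S$ is a locally finite $\pi_1(S)$-invariant Borel measure on $\mathcal G(\tilde S)$; the space $\mathscr C(S)$ of geodesic currents carries the weak-$\star$ topology, tested against continuous compactly supported functions on $\mathcal G(\tilde S)$. A current is internal in $S$ if it gives mass zero to each point of $\mathcal G(\tilde S)$ that is the pair of endpoints of a lift of a boundary curve of $S$; $\mathscr C_0(S)$ is the set of internal currents. Let $R=\coprod_i R_i$ be a possibly disconnected compact subsurface of $S$ (with finitely many components), all of whose components have negative Euler characteristic, and let $I:R\to S$ be a geodesic realization of $R$: the interior of $R$ is mapped homeomorphically onto its image and each boundary curve of $R$ is mapped homeomorphically onto a closed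 geodesic of $S$ (two boundary curves may have the same image). Endow $R$ with the pulled-back hyperbolic metric and orientation, so that $I$ lifts on each component to an isometric embedding $\tilde R_i\to\tilde S$, which induces $\tilde I:\mathcal G(\tilde R_i)\to\mathcal G(\tilde S)$. Currents, and internal currents, on $R$ are families $(c_i)_i$ of currents, respectively internal currents, on the $R_i$. The push-forward of $(c_i)_i$ is $$I\big((c_i)_i\big)=\sum_i\ \sum_{[g]\in\pi_1(S)/I_*\pi_1(R_i)} g\cdot\tilde I_*(c_i).$$ Let $\mathscr C_R(S)\subset\mathscr C(S)$, the set of currents on $S$ that are internal in $R$, be the image of $\mathscr C_0(R)$ under push-forward. Then $\mathscr C_R(S)$ is a Borel subset of $\mathscr C(S)$. -/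

import Mathlib

open Set Filter Topology MeasureTheory UpperHalfPlane
open scoped MatrixGroups OnePoint

noncomputable section

namespace SurfaceCurrents

/-! ### The circle at infinity of the hyperbolic plane -/

/-- The inclusion of the hyperbolic plane in the Riemann sphere. -/
def toSphere (z : ℍ) : OnePoint ℂ := ((z : ℂ) : OnePoint ℂ)

/-- The inclusion of the circle at infinity `ℝ ∪ {∞}` in the Riemann sphere. -/
def circleToSphere (x : OnePoint ℝ) : OnePoint ℂ := OnePoint.map Complex.ofRealHom x

/-- The ideal boundary of a subset `K` of the hyperbolic plane: the points of the circle at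
infinity that lie in the closure of `K`. -/
def idealBoundary (K : Set ℍ) : Set (OnePoint ℝ) :=
  {x | circleToSphere x ∈ closure (toSphere '' K)}

/-- The action of `SL(2, ℝ)` on the circle at infinity by Möbius transformations. -/
def circleMap (g : SL(2, ℝ)) (x : OnePoint ℝ) : OnePoint ℝ :=
  (Matrix.SpecialLinearGroup.toGL g) • x

theorem circleMap_injective (g : SL(2, ℝ)) : Function.Injective (circleMap g) :=
  MulAction.injective (Matrix.SpecialLinearGroup.toGL g)

theorem tendsto_ite_div {α : Type*} {l : Filter α} {u v : α → ℂ} {u₀ v₀ : ℂ}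
    (hu : Tendsto u l (𝓝 u₀)) (hv : Tendsto v l (𝓝 v₀)) (h : u₀ ≠ 0 ∨ v₀ ≠ 0) :
    Tendsto (fun x => if v x = 0 then (∞ : OnePoint ℂ) else ((u x / v x : ℂ) : OnePoint ℂ)) l
      (𝓝 (if v₀ = 0 then (∞ : OnePoint ℂ) else ((u₀ / v₀ : ℂ) : OnePoint ℂ))) := by
  by_cases hv0 : v₀ = 0
  · have hu0 : u₀ ≠ 0 := by tauto
    rw [if_pos hv0]
    subst hv0
    rw [OnePoint.hasBasis_nhds_infty.tendsto_right_iff]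
    rintro s ⟨-, hs⟩
    obtain ⟨M, hMpos, hM⟩ := hs.isBounded.exists_pos_norm_le
    have hupos : 0 < ‖u₀‖ := norm_pos_iff.2 hu0
    have h1 : ∀ᶠ x in l, ‖u₀‖ / 2 < ‖u x‖ :=
      hu.norm.eventually (lt_mem_nhds (by linarith))
    have h2 : ∀ᶠ x in l, ‖v x‖ < ‖u₀‖ / (2 * M) :=
      hv.norm.eventually (gt_mem_nhds (by rw [norm_zero]; positivity))
    filter_upwards [h1, h2] with x hx1 hx2
    by_cases hvx : v x = 0
    · simp [hvx]
    · simp only [hvx, if_false]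
      refine Or.inl ⟨u x / v x, fun hmem => ?_, rfl⟩
      have h3 := hM _ hmem
      rw [norm_div, div_le_iff₀ (norm_pos_iff.2 hvx)] at h3
      rw [lt_div_iff₀ (by positivity)] at hx2
      nlinarith
  · rw [if_neg hv0]
    have h1 : ∀ᶠ x in l, v x ≠ 0 := hv.eventually_ne hv0
    have h2 : Tendsto (fun x => ((u x / v x : ℂ) : OnePoint ℂ)) l
        (𝓝 ((u₀ / v₀ : ℂ) : OnePoint ℂ)) :=
      (OnePoint.continuous_coe.tendsto _).comp (hu.div hv hv0)
    refine h2.congr' ?_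
    filter_upwards [h1] with x hx
    rw [if_neg hx]

theorem continuous_moebius (g : GL (Fin 2) ℂ) : Continuous (fun x : OnePoint ℂ => g • x) := by
  have hdet : g 0 0 * g 1 1 - g 0 1 * g 1 0 ≠ 0 := by
    have := g.det_ne_zero
    rwa [Matrix.det_fin_two] at this
  rw [OnePoint.continuous_iff]
  constructor
  · have hinv : Tendsto (fun z : ℂ => z⁻¹) (coclosedCompact ℂ) (𝓝 0) := by
      rw [coclosedCompact_eq_cocompact, ← Metric.cobounded_eq_cocompact]
      exact tendsto_inv₀_cobounded
    have hu : Tendsto (fun z : ℂ => g 0 0 + g 0 1 * z⁻¹) (coclosedCompact ℂ) (𝓝 (g 0 0)) := by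
      simpa using (hinv.const_mul (g 0 1)).const_add (g 0 0)
    have hv : Tendsto (fun z : ℂ => g 1 0 + g 1 1 * z⁻¹) (coclosedCompact ℂ) (𝓝 (g 1 0)) := by
      simpa using (hinv.const_mul (g 1 1)).const_add (g 1 0)
    have h := tendsto_ite_div hu hv (by
      by_contra hc
      push Not at hc
      exact hdet (by rw [hc.1, hc.2]; ring))
    rw [OnePoint.smul_infty_eq_ite]
    refine h.congr' ?_
    have hne : ∀ᶠ z : ℂ in coclosedCompact ℂ, z ≠ 0 := by
      rw [coclosedCompact_eq_cocompact, ← Metric.cobounded_eq_cocompact]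
      exact Bornology.eventually_ne_cobounded 0
    filter_upwards [hne] with z hz
    rw [OnePoint.smul_some_eq_ite]
    have e1 : g 1 0 * z + g 1 1 = z * (g 1 0 + g 1 1 * z⁻¹) := by field_simp
    have e2 : g 0 0 * z + g 0 1 = z * (g 0 0 + g 0 1 * z⁻¹) := by field_simp
    rw [e1, e2, mul_div_mul_left _ _ hz]
    simp only [mul_eq_zero, hz, false_or]
  · rw [continuous_iff_continuousAt]
    intro z
    have hu : Tendsto (fun z : ℂ => g 0 0 * z + g 0 1) (𝓝 z) (𝓝 (g 0 0 * z + g 0 1)) :=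
      Continuous.tendsto (by fun_prop) z
    have hv : Tendsto (fun z : ℂ => g 1 0 * z + g 1 1) (𝓝 z) (𝓝 (g 1 0 * z + g 1 1)) :=
      Continuous.tendsto (by fun_prop) z
    have h := tendsto_ite_div hu hv (by
      by_contra hc
      push Not at hc
      apply hdet
      by_cases h10 : g 1 0 = 0
      · have h11 : g 1 1 = 0 := by simpa [h10] using hc.2
        rw [h10, h11]; ring
      · apply mul_left_cancel₀ h10
        linear_combination (-(g 1 0) ^ 2) * hc.1 + (g 0 0 * g 1 0) * hc.2)
    simp only [ContinuousAt, OnePoint.smul_some_eq_ite]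
    exact h

theorem toSphere_smul (g : SL(2, ℝ)) (z : ℍ) :
    toSphere (g • z) =
      ((Matrix.SpecialLinearGroup.toGL g).map Complex.ofRealHom) • toSphere z := by
  have hd : (g 1 0 : ℂ) * z + (g 1 1 : ℂ) ≠ 0 :=
    denom_ne_zero (Matrix.SpecialLinearGroup.toGL g) z
  rw [toSphere, toSphere, coe_specialLinearGroup_apply, OnePoint.smul_some_eq_ite]
  simp [hd]

theorem circleMap_mem_idealBoundary {K L : Set ℍ} {g : SL(2, ℝ)} (h : ∀ z ∈ K, g • z ∈ L)
    {x : OnePoint ℝ} (hx : x ∈ idealBoundary K) : circleMap g x ∈ idealBoundary L := by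
  rw [idealBoundary, mem_ofPred_eq] at hx ⊢
  rw [circleMap, circleToSphere, OnePoint.map_smul]
  have h1 := image_closure_subset_closure_image
    (continuous_moebius ((Matrix.SpecialLinearGroup.toGL g).map Complex.ofRealHom))
    (mem_image_of_mem _ hx)
  refine closure_mono ?_ h1
  rintro _ ⟨_, ⟨z, hz, rfl⟩, rfl⟩
  exact ⟨g • z, h z hz, toSphere_smul g z⟩

/-! ### The space of bi-infinite geodesics -/

/-- The topology of the space of unordered pairs: the quotient topology. -/
instance sym2Topology {X : Type*} [TopologicalSpace X] : TopologicalSpace (Sym2 X) :=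
  TopologicalSpace.coinduced (fun p : X × X => s(p.1, p.2)) inferInstance

/-- The space of bi-infinite geodesics of `K`: the unordered pairs of distinct points of the
ideal boundary of `K`. -/
def Geod (K : Set ℍ) : Type :=
  {e : Sym2 (OnePoint ℝ) // ¬ e.IsDiag ∧ ∀ x ∈ e, x ∈ idealBoundary K}

instance (K : Set ℍ) : TopologicalSpace (Geod K) :=
  inferInstanceAs (TopologicalSpace
    {e : Sym2 (OnePoint ℝ) // ¬ e.IsDiag ∧ ∀ x ∈ e, x ∈ idealBoundary K})

instance (K : Set ℍ) : MeasurableSpace (Geod K) := borel _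

instance (K : Set ℍ) : BorelSpace (Geod K) := ⟨rfl⟩

/-- The map between spaces of geodesics induced by an orientation-preserving isometry `g` of the
hyperbolic plane that maps `K` into `L`. -/
def Geod.map {K L : Set ℍ} (g : SL(2, ℝ)) (h : ∀ z ∈ K, g • z ∈ L) (e : Geod K) : Geod L :=
  ⟨Sym2.map (circleMap g) e.1, by
    refine ⟨fun hd => e.2.1 ((Sym2.isDiag_map (circleMap_injective g)).1 hd), fun x hx => ?_⟩
    obtain ⟨y, hy, rfl⟩ := Sym2.mem_map.1 hx
    exact circleMap_mem_idealBoundary h (e.2.2 y hy)⟩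

/-- The complete geodesic with set of endpoints `e` runs inside the frontier of `K`. -/
def Geod.IsBoundary {K : Set ℍ} (e : Geod K) : Prop :=
  ∃ (γ : ℝ → ℍ) (x y : OnePoint ℝ), Isometry γ ∧ (∀ t, γ t ∈ frontier K) ∧
    Tendsto (fun t => toSphere (γ t)) atBot (𝓝 (circleToSphere x)) ∧
    Tendsto (fun t => toSphere (γ t)) atTop (𝓝 (circleToSphere y)) ∧
    e.1 = s(x, y)

/-! ### Hyperbolic surfaces with geodesic boundary -/

/-- An oriented hyperbolic metric with geodesic boundary on the compact connected space `S`, given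
by the identification of the universal cover of `S` with a closed convex subset `cover` of the
hyperbolic plane that is bounded by complete geodesics, the deck transformations being
(restrictions of) orientation-preserving isometries of the hyperbolic plane. The metric, the
orientation and the smooth structure of `S` are those for which `proj` is a local isometry. By
Gauss-Bonnet the Euler characteristic of `S` is negative, and each compact connected oriented surface
with negative Euler characteristic carries such metrics. -/
structure HyperbolicSurface (S : Type*) [TopologicalSpace S] where
  /-- the universal cover, as a subset of the hyperbolic plane -/
  cover : Set ℍ
  isClosed_cover : IsClosed cover
  /-- `cover` contains the geodesic segment between any two of its points -/
  convex_cover : ∀ x ∈ cover, ∀ y ∈ cover, ∀ z : ℍ, dist x z + dist z y = dist x y → z ∈ cover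
  nonempty_interior : (interior cover).Nonempty
  /-- the frontier of `cover` consists of complete geodesics -/
  geodesic_frontier : ∀ z ∈ frontier cover,
    ∃ γ : ℝ → ℍ, Isometry γ ∧ (∀ t, γ t ∈ frontier cover) ∧ ∃ t, γ t = z
  /-- the universal covering map -/
  proj : cover → S
  isCoveringMap_proj : IsCoveringMap proj
  surjective_proj : Function.Surjective proj
  /-- two points of the same fibre are exchanged by a deck transformation that is the restriction
  of an orientation-preserving isometry -/
  exists_deck : ∀ z w : cover, proj z = proj w →
    ∃ (g : SL(2, ℝ)) (h : ∀ u : ℍ, g • u ∈ cover ↔ u ∈ cover),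
      (∀ u : cover, proj ⟨g • (u : ℍ), (h u).2 u.2⟩ = proj u) ∧ g • (z : ℍ) = w

namespace HyperbolicSurface

variable {S : Type*} [TopologicalSpace S] (h : HyperbolicSurface S)

/-- The fundamental group of `S`, acting by deck transformations; it is described by its preimage
in `SL(2, ℝ)`, which also contains `-1`, the matrix that acts trivially. -/
def deck : Subgroup SL(2, ℝ) where
  carrier := {g | ∃ hg : ∀ u : ℍ, g • u ∈ h.cover ↔ u ∈ h.cover,
    ∀ u : h.cover, h.proj ⟨g • (u : ℍ), (hg u).2 u.2⟩ = h.proj u}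
  one_mem' := ⟨fun u => by rw [one_smul], fun u => by simp only [one_smul, Subtype.coe_eta]⟩
  mul_mem' := by
    rintro a b ⟨ha, ha'⟩ ⟨hb, hb'⟩
    refine ⟨fun u => by rw [mul_smul, ha, hb], fun u => ?_⟩
    have h1 := ha' ⟨b • (u : ℍ), (hb u).2 u.2⟩
    rw [hb' u] at h1
    rw [← h1]
    simp only [mul_smul]
  inv_mem' := by
    rintro a ⟨ha, ha'⟩
    have ha1 : ∀ u : ℍ, a⁻¹ • u ∈ h.cover ↔ u ∈ h.cover := fun u => by
      rw [← ha, smul_inv_smul]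
    refine ⟨ha1, fun u => ?_⟩
    rw [← ha' ⟨a⁻¹ • (u : ℍ), (ha1 u).2 u.2⟩]
    simp only [smul_inv_smul, Subtype.coe_eta]

theorem smul_mem_cover {g : SL(2, ℝ)} (hg : g ∈ h.deck) : ∀ z ∈ h.cover, g • z ∈ h.cover :=
  fun z hz => (hg.1 z).2 hz

/-- The boundary of the surface. -/
def boundary : Set S := {s | ∃ z : h.cover, (z : ℍ) ∈ frontier h.cover ∧ h.proj z = s}

/-! ### Geodesic currents -/

/-- The geodesic currents on a compact hyperbolic surface: the locally finite Borel measures on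
the space of bi-infinite geodesics of the universal cover that are invariant under the fundamental
group. -/
structure Current where
  /-- the underlying measure -/
  measure : Measure (Geod h.cover)
  isLocallyFinite : IsLocallyFiniteMeasure measure
  invariant : ∀ (g : SL(2, ℝ)) (hg : g ∈ h.deck),
    measure.map (Geod.map g (h.smul_mem_cover hg)) = measure

/-- The weak-* topology: the coarsest topology that makes `c ↦ ∫ f dc` continuous for each
continuous function `f` with compact support. -/
instance : TopologicalSpace h.Current :=
  ⨅ f : {f : Geod h.cover → ℝ // Continuous f ∧ HasCompactSupport f},
    TopologicalSpace.induced (fun c : h.Current => ∫ e, f.1 e ∂c.measure) inferInstance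

instance : MeasurableSpace h.Current := borel _

instance : BorelSpace h.Current := ⟨rfl⟩

variable {h} in
/-- A current is internal if it gives mass zero to every lift of every boundary curve. -/
def Current.IsInternal (c : h.Current) : Prop :=
  ∀ e : Geod h.cover, e.IsBoundary → c.measure {e} = 0

end HyperbolicSurface

/-! ### Geodesic realizations of a subsurface and push-forward of currents -/

/-- A geodesic realization in the hyperbolic surface `S` of a surface with connected components
`R i`: a map from the disjoint union of the `R i` to `S` which is a homeomorphism from the interior
onto its image and maps each boundary curve homeomorphically onto a closed geodesic. Each `R i`
carries the pulled-back metric, which means that the map lifts to an (orientation-preserving)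
isometric embedding of universal covers; it sends boundary geodesics to geodesics. A lift
is chosen on each component. -/
structure GeodesicRealization {S : Type*} [TopologicalSpace S] (hS : HyperbolicSurface S)
    {ι : Type*} {R : ι → Type*} [∀ i, TopologicalSpace (R i)]
    (hR : ∀ i, HyperbolicSurface (R i)) where
  /-- the map from the disjoint union of the components to `S` -/
  toFun : (Σ i, R i) → S
  /-- the lift of the `i`-th component to the universal covers -/
  lift : ι → SL(2, ℝ)
  lift_mem : ∀ i, ∀ z ∈ (hR i).cover, lift i • z ∈ hS.cover
  proj_lift : ∀ i, ∀ z : (hR i).cover,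
    hS.proj ⟨lift i • (z : ℍ), lift_mem i z z.2⟩ = toFun ⟨i, (hR i).proj z⟩
  isEmbedding_interior :
    IsEmbedding (fun x : {x : Σ i, R i // x.2 ∉ (hR x.1).boundary} => toFun x)
  injOn_boundary : ∀ i, ∀ x ∈ (hR i).boundary,
    InjOn (fun y => toFun ⟨i, y⟩) (connectedComponentIn (hR i).boundary x)

namespace GeodesicRealization

variable {S : Type*} [TopologicalSpace S] {hS : HyperbolicSurface S}
  {ι : Type*} {R : ι → Type*} [∀ i, TopologicalSpace (R i)] {hR : ∀ i, HyperbolicSurface (R i)}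
  (I : GeodesicRealization hS hR)

/-- The image of the fundamental group of `R i` in the fundamental group of `S` under the
homomorphism induced by the realization and the chosen lift. -/
def imageDeck (i : ι) : Subgroup hS.deck :=
  ((hR i).deck.map (MulAut.conj (I.lift i)).toMonoidHom).subgroupOf hS.deck

theorem smul_lift_mem (i : ι) (g : hS.deck) :
    ∀ z ∈ (hR i).cover, ((g : SL(2, ℝ)) * I.lift i) • z ∈ hS.cover := fun z hz => by
  rw [mul_smul]
  exact hS.smul_mem_cover g.2 _ (I.lift_mem i z hz)

/-- The push-forward of a current of the `i`-th component: the sum, over the classes `[g]` in the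
quotient of the fundamental group of `S` by the image of the one of `R i`, of the translates by `g`
of the image measure under the lift. By invariance of the current, the
translate depends only on the class. -/
def pushComponent (i : ι) (c : (hR i).Current) : Measure (Geod hS.cover) :=
  Measure.sum fun q : hS.deck ⧸ I.imageDeck i =>
    c.measure.map (Geod.map ((q.out : SL(2, ℝ)) * I.lift i) (I.smul_lift_mem i q.out))

/-- The push-forward of a current of the disjoint union of the components, which is a family of
currents, one on each component. -/
def push (c : ∀ i, (hR i).Current) : Measure (Geod hS.cover) :=
  Measure.sum fun i => I.pushComponent i (c i)

/-- The currents of `S` that are internal in `R`: the push-forwards of the internal currents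
of `R`. -/
def internalCurrents : Set hS.Current :=
  {c | ∃ c' : ∀ i, (hR i).Current, (∀ i, (c' i).IsInternal) ∧ c.measure = I.push c'}

end GeodesicRealization

end SurfaceCurrents

end

noncomputable section

/-! Call a piece the set of geodesics of `S` coming from non-boundary geodesics of one component `R
i`, carried into `S` by one translate of its lifted cover. The internal currents turn out to be
exactly the currents of `S` that vanish off the union of the pieces (`internalCurrents_eq`). This is
a Borel condition, because the mass of a fixed Borel set is a Borel function of the current
(`measurable_measure`).

A push-forward of internal currents vanishes off the pieces because boundary geodesics are countably
many (`countable_isBoundary`), so that together they have mass zero. Conversely, a current that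
vanishes off the pieces can be pulled back to the non-boundary geodesics of each component. This
gives internal currents, and their push-forward is the given current (`push_restrictCurrent`) since
the pieces are countably many and disjoint.

The geometry lies in this disjointness (`pairwise_disjoint_piece`). Different translates have
disjoint interiors, because the realization is injective on the interior of `R`; this also makes
them countable. A geodesic common to two closed convex sets with disjoint interiors runs in the
frontier (`isBoundary_of_disjoint_interior`). Convexity is handled in a Klein chart, where
hyperbolic segments are straight. -/

namespace SurfaceCurrents

/-! ### The Klein model above a parabola -/

/-- The chart of the hyperbolic plane with image the region above the parabola `v = u ^ 2`, in
which geodesics are straight. -/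
def klein (z : ℍ) : ℝ × ℝ := (z.re, z.re ^ 2 + z.im ^ 2)

theorem continuous_klein : Continuous klein := by
  unfold klein
  have h1 := UpperHalfPlane.continuous_re
  have h2 := UpperHalfPlane.continuous_im
  fun_prop

theorem range_klein : range klein = {p : ℝ × ℝ | p.1 ^ 2 < p.2} := by
  ext p
  constructor
  · rintro ⟨z, rfl⟩
    have := z.im_pos
    simp only [klein, mem_ofPred_eq]
    nlinarith
  · intro hp
    have hp' : 0 < p.2 - p.1 ^ 2 := sub_pos.2 hp
    refine ⟨⟨⟨p.1, √(p.2 - p.1 ^ 2)⟩, Real.sqrt_pos.2 hp'⟩, ?_⟩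
    ext
    · rfl
    · change p.1 ^ 2 + √(p.2 - p.1 ^ 2) ^ 2 = p.2
      rw [Real.sq_sqrt hp'.le]
      ring

theorem isOpenEmbedding_klein : IsOpenEmbedding klein := by
  have hc : Continuous fun p : ℝ × ℝ => (⟨p.1, √(p.2 - p.1 ^ 2)⟩ : ℂ) := by
    have : (fun p : ℝ × ℝ => (⟨p.1, √(p.2 - p.1 ^ 2)⟩ : ℂ)) =
        fun p : ℝ × ℝ => (p.1 : ℂ) + (√(p.2 - p.1 ^ 2) : ℝ) * Complex.I := by
      ext p
      exact Complex.mk_eq_add_mul_I _ _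
    rw [this]
    fun_prop
  have hl : (fun p : ℝ × ℝ => (⟨p.1, √(p.2 - p.1 ^ 2)⟩ : ℂ)) ∘ klein = ((↑) : ℍ → ℂ) := by
    funext z
    apply Complex.ext
    · rfl
    · simp [klein, Real.sqrt_sq z.im_pos.le]
  refine ⟨IsEmbedding.of_comp continuous_klein hc (hl ▸ UpperHalfPlane.isEmbedding_coe), ?_⟩
  rw [range_klein]
  exact isOpen_lt (by fun_prop) (by fun_prop)

/-- The vectors `(1, re, re² + im²) / im` form a hyperboloid on which a bilinear form gives `cosh`
of the distance. A chart segment lifts to a nonnegative combination of two such vectors, and the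
addition formula for `cosh` concludes. -/
theorem dist_add_dist_of_klein_mem_segment {x y z : ℍ}
    (h : klein z ∈ segment ℝ (klein x) (klein y)) : dist x z + dist z y = dist x y := by
  obtain ⟨a, b, ha, hb, hab, h⟩ := h
  have h1 : a * x.re + b * y.re = z.re := congrArg Prod.fst h
  have h2 : a * (x.re ^ 2 + x.im ^ 2) + b * (y.re ^ 2 + y.im ^ 2) = z.re ^ 2 + z.im ^ 2 :=
    congrArg Prod.snd h
  have hx := x.im_pos
  have hy := y.im_pos
  have hz := z.im_pos
  -- `l` and `m` are the coefficients of the hyperboloid vector of `z` in those of `x` and `y`; `h3`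
  -- below says that this vector has norm 1.
  obtain ⟨l, hl⟩ : ∃ l, l = a * x.im / z.im := ⟨_, rfl⟩
  obtain ⟨m, hm⟩ : ∃ m, m = b * y.im / z.im := ⟨_, rfl⟩
  have hl0 : 0 ≤ l := by rw [hl]; positivity
  have hm0 : 0 ≤ m := by rw [hm]; positivity
  have hb' : b = 1 - a := by linarith
  have hA : Real.cosh (dist x z) = l + m * Real.cosh (dist x y) := by
    rw [cosh_dist', cosh_dist', hl, hm]
    field_simp
    subst hb'
    linear_combination (2 * x.re) * h1 - h2
  have hB : Real.cosh (dist z y) = l * Real.cosh (dist x y) + m := by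
    rw [cosh_dist', cosh_dist', hl, hm]
    field_simp
    subst hb'
    linear_combination (2 * y.re) * h1 - h2
  have h3 : l ^ 2 + m ^ 2 + 2 * l * m * Real.cosh (dist x y) = 1 := by
    rw [cosh_dist', hl, hm]
    field_simp
    subst hb'
    linear_combination h2 - (a * x.re + (1 - a) * y.re + z.re) * h1
  have hS : 0 ≤ Real.sinh (dist x y) := Real.sinh_nonneg_iff.2 dist_nonneg
  have hsq := Real.cosh_sq (dist x y)
  have hs1 : Real.sinh (dist x z) = m * Real.sinh (dist x y) := by
    rw [← abs_of_nonneg (Real.sinh_nonneg_iff.2 (dist_nonneg (x := x) (y := z))),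
      ← abs_of_nonneg (mul_nonneg hm0 hS), ← sq_eq_sq_iff_abs_eq_abs, Real.sinh_sq, hA]
    linear_combination h3 + m ^ 2 * hsq
  have hs2 : Real.sinh (dist z y) = l * Real.sinh (dist x y) := by
    rw [← abs_of_nonneg (Real.sinh_nonneg_iff.2 (dist_nonneg (x := z) (y := y))),
      ← abs_of_nonneg (mul_nonneg hl0 hS), ← sq_eq_sq_iff_abs_eq_abs, Real.sinh_sq, hB]
    linear_combination h3 + l ^ 2 * hsq
  have h4 : Real.cosh (dist x z + dist z y) = Real.cosh (dist x y) := by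
    rw [Real.cosh_add, hA, hB, hs1, hs2]
    linear_combination Real.cosh (dist x y) * h3 - l * m * hsq
  have h5 := le_antisymm (Real.cosh_le_cosh.1 h4.le) (Real.cosh_le_cosh.1 h4.ge)
  rwa [abs_of_nonneg (by positivity), abs_of_nonneg dist_nonneg] at h5

/-- Additivity of distances makes the Gram determinant of the three hyperboloid vectors vanish, and
up to a nonzero factor that determinant is the square of the collinearity defect. -/
theorem klein_collinear_of_dist_add_dist {x y z : ℍ} (h : dist x z + dist z y = dist x y) :
    ((klein y).1 - (klein x).1) * ((klein z).2 - (klein x).2) =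
      ((klein z).1 - (klein x).1) * ((klein y).2 - (klein x).2) := by
  have hx := x.im_pos
  have hy := y.im_pos
  have hz := z.im_pos
  have h1 : (Real.cosh (dist x y) - Real.cosh (dist x z) * Real.cosh (dist z y)) ^ 2 =
      (Real.cosh (dist x z) ^ 2 - 1) * (Real.cosh (dist z y) ^ 2 - 1) := by
    rw [← h, Real.cosh_add, ← Real.sinh_sq, ← Real.sinh_sq]
    ring
  have h2 : (2 * x.im * y.im * z.im) ^ 2 *
      ((Real.cosh (dist x z) ^ 2 - 1) * (Real.cosh (dist z y) ^ 2 - 1) -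
        (Real.cosh (dist x y) - Real.cosh (dist x z) * Real.cosh (dist z y)) ^ 2) =
      (((klein y).1 - (klein x).1) * ((klein z).2 - (klein x).2) -
      ((klein z).1 - (klein x).1) * ((klein y).2 - (klein x).2)) ^ 2 := by
    rw [cosh_dist', cosh_dist', cosh_dist']
    simp only [klein]
    field_simp
    ring
  rw [h1, sub_self, mul_zero] at h2
  exact sub_eq_zero.1 (pow_eq_zero_iff two_ne_zero |>.1 h2.symm)

/-! ### Hyperbolic convexity as convexity in the chart -/

theorem convex_range_klein : Convex ℝ (range klein) := by
  have h := (even_two.convexOn_pow (𝕜 := ℝ)).convex_strict_epigraph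
  rw [range_klein]
  simpa using h

/-- Convexity of subsets of the hyperbolic plane, in terms of the metric. -/
def IsHypConvex (K : Set ℍ) : Prop :=
  ∀ x ∈ K, ∀ y ∈ K, ∀ z : ℍ, dist x z + dist z y = dist x y → z ∈ K

theorem IsHypConvex.convex_image_klein {K : Set ℍ} (hK : IsHypConvex K) :
    Convex ℝ (klein '' K) := by
  rw [convex_iff_segment_subset]
  rintro _ ⟨x, hx, rfl⟩ _ ⟨y, hy, rfl⟩ p hp
  obtain ⟨z, rfl⟩ := convex_range_klein.segment_subset (mem_range_self x) (mem_range_self y) hp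
  exact ⟨z, hK x hx y hy z (dist_add_dist_of_klein_mem_segment hp), rfl⟩

theorem IsHypConvex.isPreconnected {K : Set ℍ} (hK : IsHypConvex K) : IsPreconnected K :=
  isOpenEmbedding_klein.isInducing.isPreconnected_image.1 hK.convex_image_klein.isPreconnected

theorem mem_interior_iff_klein {K : Set ℍ} {z : ℍ} :
    z ∈ interior K ↔ klein z ∈ interior (klein '' K) := by
  rw [← mem_preimage, isOpenEmbedding_klein.isOpenMap.preimage_interior_eq_interior_preimage
    continuous_klein, preimage_image_eq _ isOpenEmbedding_klein.injective]

theorem mem_closure_iff_klein {K : Set ℍ} {z : ℍ} :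
    z ∈ closure K ↔ klein z ∈ closure (klein '' K) := by
  rw [← mem_preimage, isOpenEmbedding_klein.isOpenMap.preimage_closure_eq_closure_preimage
    continuous_klein, preimage_image_eq _ isOpenEmbedding_klein.injective]

theorem IsHypConvex.klein_mem_closure_interior {K : Set ℍ} (hK : IsHypConvex K)
    (hi : (interior K).Nonempty) {z : ℍ} (hz : z ∈ K) :
    klein z ∈ closure (interior (klein '' K)) := by
  obtain ⟨w, hw⟩ := hi
  rw [hK.convex_image_klein.closure_interior_eq_closure_of_nonempty_interior
    ⟨_, mem_interior_iff_klein.1 hw⟩]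
  exact subset_closure (mem_image_of_mem _ hz)

theorem IsHypConvex.subset_closure_interior {K : Set ℍ} (hK : IsHypConvex K)
    (hi : (interior K).Nonempty) : K ⊆ closure (interior K) := fun z hz => by
  have h := hK.klein_mem_closure_interior hi hz
  rw [← mem_preimage, isOpenEmbedding_klein.isOpenMap.preimage_closure_eq_closure_preimage
    continuous_klein] at h
  exact closure_mono (fun w hw => mem_interior_iff_klein.2 hw) h

theorem isHypConvex_preimage_smul {K : Set ℍ} (hK : IsHypConvex K) (g : SL(2, ℝ)) :
    IsHypConvex ((g • ·) ⁻¹' K) := fun x hx y hy z h =>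
  hK _ hx _ hy _ (by simpa only [dist_smul] using h)

/-! ### Points of the ideal boundary -/

theorem coe_mem_idealBoundary_iff {K : Set ℍ} {a : ℝ} :
    (a : OnePoint ℝ) ∈ idealBoundary K ↔ ∀ ε > 0, ∃ z ∈ K, dist (a : ℂ) (z : ℂ) < ε := by
  have h : toSphere '' K = (fun z : ℂ => (z : OnePoint ℂ)) '' (((↑) : ℍ → ℂ) '' K) := by
    rw [image_image]
    rfl
  rw [idealBoundary, mem_ofPred_eq, h]
  change ((fun z : ℂ => (z : OnePoint ℂ)) (a : ℂ)) ∈ _ ↔ _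
  rw [← mem_preimage, OnePoint.isOpenEmbedding_coe.isOpenMap.preimage_closure_eq_closure_preimage
    OnePoint.continuous_coe, preimage_image_eq _ OnePoint.isOpenEmbedding_coe.injective,
    Metric.mem_closure_iff]
  simp only [exists_mem_image]

theorem exists_norm_gt_of_infty_mem_idealBoundary {K : Set ℍ} (h : ∞ ∈ idealBoundary K) (r : ℝ) :
    ∃ z ∈ K, r < ‖(z : ℂ)‖ := by
  have ho : IsOpen ((fun z : ℂ => (z : OnePoint ℂ)) '' Metric.closedBall 0 r)ᶜ :=
    OnePoint.isOpen_compl_image_coe.2 ⟨Metric.isClosed_closedBall, isCompact_closedBall 0 r⟩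
  obtain ⟨_, h1, z, hz, rfl⟩ := mem_closure_iff.1 h _ ho (by
    rintro ⟨z, -, hz⟩
    exact OnePoint.coe_ne_infty z hz)
  refine ⟨z, hz, not_le.1 fun hle => h1 ⟨z, by simpa using hle, rfl⟩⟩

theorem mem_idealBoundary_preimage_smul {K : Set ℍ} {g : SL(2, ℝ)} {x : OnePoint ℝ} :
    x ∈ idealBoundary ((g • ·) ⁻¹' K) ↔ circleMap g x ∈ idealBoundary K := by
  refine ⟨circleMap_mem_idealBoundary fun z hz => hz, fun h => ?_⟩
  have h1 := circleMap_mem_idealBoundary (g := g⁻¹) (L := (g • ·) ⁻¹' K)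
    (fun z hz => by simpa using hz) h
  simpa [circleMap] using h1

theorem circleMap_infty (g : SL(2, ℝ)) :
    circleMap g ∞ = if g 1 0 = 0 then ∞ else ((g 0 0 / g 1 0 : ℝ) : OnePoint ℝ) :=
  OnePoint.smul_infty_eq_ite _

theorem circleMap_zero (g : SL(2, ℝ)) : circleMap g ((0 : ℝ) : OnePoint ℝ) =
    if g 1 1 = 0 then ∞ else ((g 0 1 / g 1 1 : ℝ) : OnePoint ℝ) := by
  rw [circleMap, OnePoint.smul_some_eq_ite]
  simp only [mul_zero, zero_add]
  rfl

theorem exists_specialLinear {a b c d : ℝ} (h : a * d - b * c = 1) :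
    ∃ g : SL(2, ℝ), g 0 0 = a ∧ g 0 1 = b ∧ g 1 0 = c ∧ g 1 1 = d :=
  ⟨⟨!![a, b; c, d], by rw [Matrix.det_fin_two_of, h]⟩, rfl, rfl, rfl, rfl⟩

/-- This normalizes any geodesic to the imaginary axis. The matrices are found from `∞ ↦ a / c`, `0
↦ b / d` and determinant 1. -/
theorem exists_circleMap_eq {x y : OnePoint ℝ} (h : x ≠ y) :
    ∃ g : SL(2, ℝ), circleMap g ∞ = x ∧ circleMap g ((0 : ℝ) : OnePoint ℝ) = y := by
  simp only [circleMap_infty, circleMap_zero]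
  induction x using OnePoint.rec with
  | infty =>
    induction y using OnePoint.rec with
    | infty => exact absurd rfl h
    | coe b =>
      obtain ⟨g, -, h01, h10, h11⟩ :=
        exists_specialLinear (a := 1) (b := b) (c := 0) (d := 1) (by ring)
      exact ⟨g, by simp [h10], by simp [h01, h11]⟩
  | coe a =>
    induction y using OnePoint.rec with
    | infty =>
      obtain ⟨g, h00, -, h10, h11⟩ :=
        exists_specialLinear (a := a) (b := -1) (c := 1) (d := 0) (by ring)
      exact ⟨g, by simp [h00, h10], by simp [h11]⟩
    | coe b =>
      have hab : a - b ≠ 0 := sub_ne_zero.2 fun h' => h (by rw [h'])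
      obtain ⟨g, h00, h01, h10, h11⟩ := exists_specialLinear (a := a) (b := b * (a - b)⁻¹)
        (c := 1) (d := (a - b)⁻¹) (by field_simp)
      exact ⟨g, by simp [h00, h10], by simp [h01, h11, hab]⟩

/-! ### The imaginary axis -/

/-- Points `z` of `K` of large norm `a` have chart image of height `a ^ 2` and abscissa at most `a`
in absolute value. Chart segments from `p` to them therefore become vertical, and closedness gives
the whole vertical ray above `p`. -/
theorem IsHypConvex.mem_of_infty_mem_idealBoundary {K : Set ℍ} (hK : IsHypConvex K)
    (hc : IsClosed K) (h : ∞ ∈ idealBoundary K) {p q : ℍ} (hp : p ∈ K) (hre : q.re = p.re)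
    (him : p.im ≤ q.im) : q ∈ K := by
  rw [← hc.closure_eq, mem_closure_iff_klein, Metric.mem_closure_iff]
  intro ε hε
  obtain ⟨v, hv⟩ : ∃ v, v = p.re ^ 2 + p.im ^ 2 := ⟨_, rfl⟩
  obtain ⟨D, hD⟩ : ∃ D, D = q.im ^ 2 - p.im ^ 2 := ⟨_, rfl⟩
  have hD0 : 0 ≤ D := by
    have := p.im_pos
    rw [hD]
    nlinarith
  have hv0 : 0 ≤ v := by rw [hv]; positivity
  have hdε : 0 ≤ 4 * D / ε := by positivity
  obtain ⟨z, hz, hr⟩ := exists_norm_gt_of_infty_mem_idealBoundary h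
    (1 + |p.re| + 2 * v + 2 * D + 4 * D / ε)
  obtain ⟨a, ha⟩ : ∃ a, a = ‖(z : ℂ)‖ := ⟨_, rfl⟩
  have hza : z.re ^ 2 + z.im ^ 2 = a ^ 2 := by
    rw [ha, ← Complex.normSq_eq_norm_sq, Complex.normSq_apply]
    simp only [coe_re, coe_im]
    ring
  have hzre : |z.re| ≤ a := ha ▸ Complex.abs_re_le_norm (z : ℂ)
  rw [← ha] at hr
  have hp0 := abs_nonneg p.re
  have ha1 : 1 ≤ a := by linarith
  have hav : 2 * v ≤ a ^ 2 := by nlinarith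
  have haD : v + D ≤ a ^ 2 := by nlinarith
  have hpos : 0 < a ^ 2 - v := by nlinarith
  have hmem := hK.convex_image_klein.segment_subset (mem_image_of_mem _ hp) (mem_image_of_mem _ hz)
  -- This parameter puts the point of the segment at the height of `klein q`, so only the horizontal
  -- error has to be bounded.
  obtain ⟨t, ht⟩ : ∃ t, t = D / (a ^ 2 - v) := ⟨_, rfl⟩
  have ht0 : 0 ≤ t := by rw [ht]; positivity
  have ht1 : t ≤ 1 := by
    rw [ht, div_le_one hpos]
    linarith
  refine ⟨_, hmem ⟨1 - t, t, by linarith, ht0, by ring, rfl⟩, ?_⟩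
  have e2 : (klein q).2 = ((1 - t) • klein p + t • klein z).2 := by
    simp only [klein, Prod.snd_add, Prod.smul_snd, smul_eq_mul, hza, ← hv]
    have htD : t * (a ^ 2 - v) = D := by rw [ht, div_mul_cancel₀ _ hpos.ne']
    rw [hre]
    linear_combination -hv - hD - htD
  have e1 : (klein q).1 - ((1 - t) • klein p + t • klein z).1 = t * (p.re - z.re) := by
    simp only [klein, Prod.fst_add, Prod.smul_fst, smul_eq_mul]
    rw [hre]
    ring
  rw [Prod.dist_eq, max_lt_iff, e2, dist_self, Real.dist_eq, e1, abs_mul, abs_of_nonneg ht0]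
  refine ⟨?_, hε⟩
  have h1 : |p.re - z.re| ≤ 2 * a := (abs_sub _ _).trans (by linarith)
  have h2 : t * a ≤ 2 * D / a := by
    rw [ht, le_div_iff₀ (by linarith), div_mul_eq_mul_div, div_mul_eq_mul_div, div_le_iff₀ hpos]
    nlinarith
  have h3 : 4 * D / a < ε := by
    have : 4 * D / ε < a := by linarith
    rw [div_lt_iff₀ hε] at this
    rw [div_lt_iff₀ (by linarith)]
    linarith
  calc t * |p.re - z.re| ≤ t * (2 * a) := mul_le_mul_of_nonneg_left h1 ht0
    _ ≤ 4 * D / a := by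
      have : 4 * D / a = 2 * (2 * D / a) := by ring
      linarith
    _ < ε := h3

/-- The geodesic with endpoints `0` and `∞`. -/
def imAxis : Set ℍ := {z | z.re = 0}

theorem IsHypConvex.imAxis_subset {K : Set ℍ} (hK : IsHypConvex K) (hc : IsClosed K)
    (h : ∞ ∈ idealBoundary K) (h0 : ((0 : ℝ) : OnePoint ℝ) ∈ idealBoundary K) : imAxis ⊆ K := by
  intro z hz
  rw [← hc.closure_eq, UpperHalfPlane.isEmbedding_coe.closure_eq_preimage_closure_image,
    mem_preimage, Metric.mem_closure_iff]
  intro ε hε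
  -- The bound `z.im` puts `w` below the height of `z`, so the vertical ray above `w` reaches that
  -- height; the bound `ε` makes it pass close to `z`.
  obtain ⟨w, hw, hwd⟩ := coe_mem_idealBoundary_iff.1 h0 (min ε z.im) (lt_min hε z.im_pos)
  rw [Complex.ofReal_zero, dist_zero_left, lt_min_iff] at hwd
  refine ⟨(⟨⟨w.re, z.im⟩, z.im_pos⟩ : ℍ), mem_image_of_mem _ (hK.mem_of_infty_mem_idealBoundary hc h
    hw rfl ?_), ?_⟩
  · exact ((le_abs_self _).trans (Complex.abs_im_le_norm (w : ℂ))).trans hwd.2.le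
  · have : (z : ℂ) - (⟨w.re, z.im⟩ : ℂ) = ((-w.re : ℝ) : ℂ) := by
      have hz' : z.re = 0 := hz
      apply Complex.ext <;> simp [hz']
    change dist (z : ℂ) (⟨w.re, z.im⟩ : ℂ) < ε
    rw [dist_eq_norm, this, Complex.norm_real, norm_neg]
    exact (Complex.abs_re_le_norm (w : ℂ)).trans_lt hwd.1

/-- The unit speed parametrization of the imaginary axis. -/
def axisMap (t : ℝ) : ℍ := ⟨⟨0, Real.exp t⟩, Real.exp_pos t⟩

theorem isometry_axisMap : Isometry axisMap := isometry_vertical_line 0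

theorem axisMap_mem (t : ℝ) : axisMap t ∈ imAxis := rfl

theorem norm_coe_axisMap (t : ℝ) : ‖(axisMap t : ℂ)‖ = Real.exp t := by
  have : (axisMap t : ℂ) = (Real.exp t : ℝ) * Complex.I := by
    apply Complex.ext <;> simp [axisMap, Complex.exp_ofReal_re]
  rw [this, norm_mul, Complex.norm_I, mul_one, Complex.norm_real, Real.norm_eq_abs, Real.abs_exp]

theorem tendsto_axisMap_atBot :
    Tendsto (fun t => toSphere (axisMap t)) atBot (𝓝 (circleToSphere ((0 : ℝ) : OnePoint ℝ))) := by
  refine (OnePoint.continuous_coe.tendsto _).comp (f := fun t => (axisMap t : ℂ)) ?_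
  change Tendsto _ _ (𝓝 ((0 : ℝ) : ℂ))
  rw [Complex.ofReal_zero, tendsto_zero_iff_norm_tendsto_zero]
  simp only [norm_coe_axisMap]
  exact Real.tendsto_exp_atBot

theorem tendsto_axisMap_atTop :
    Tendsto (fun t => toSphere (axisMap t)) atTop (𝓝 (circleToSphere ∞)) := by
  refine OnePoint.tendsto_coe_infty.comp (f := fun t => (axisMap t : ℂ)) ?_
  rw [coclosedCompact_eq_cocompact, ← Metric.cobounded_eq_cocompact,
    ← tendsto_norm_atTop_iff_cobounded]
  simp only [norm_coe_axisMap]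
  exact Real.tendsto_exp_atTop

theorem mem_idealBoundary_of_tendsto {K : Set ℍ} {γ : ℝ → ℍ} {l : Filter ℝ} [l.NeBot]
    {x : OnePoint ℝ} (h : Tendsto (fun t => toSphere (γ t)) l (𝓝 (circleToSphere x)))
    (hK : ∀ t, γ t ∈ K) : x ∈ idealBoundary K :=
  mem_closure_of_tendsto h (Eventually.of_forall fun t => mem_image_of_mem _ (hK t))

theorem mem_idealBoundary_imAxis {x : OnePoint ℝ} :
    x ∈ idealBoundary imAxis ↔ x = ∞ ∨ x = ((0 : ℝ) : OnePoint ℝ) := by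
  constructor
  · intro h
    induction x using OnePoint.rec with
    | infty => exact Or.inl rfl
    | coe a =>
      right
      by_contra ha
      have ha' : a ≠ 0 := fun h => ha (by rw [h])
      obtain ⟨z, hz, hd⟩ := coe_mem_idealBoundary_iff.1 h |a| (abs_pos.2 ha')
      have h1 := (Complex.abs_re_le_norm ((a : ℂ) - z)).trans_lt (dist_eq_norm (a : ℂ) z ▸ hd)
      have hz' : z.re = 0 := hz
      simp [hz'] at h1
  · rintro (rfl | rfl)
    · exact mem_idealBoundary_of_tendsto tendsto_axisMap_atTop axisMap_mem
    · exact mem_idealBoundary_of_tendsto tendsto_axisMap_atBot axisMap_mem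

theorem tendsto_toSphere_smul {γ : ℝ → ℍ} {l : Filter ℝ} {x : OnePoint ℝ} (g : SL(2, ℝ))
    (h : Tendsto (fun t => toSphere (γ t)) l (𝓝 (circleToSphere x))) :
    Tendsto (fun t => toSphere (g • γ t)) l (𝓝 (circleToSphere (circleMap g x))) := by
  simp only [toSphere_smul]
  rw [circleMap, circleToSphere, OnePoint.map_smul]
  exact ((continuous_moebius _).tendsto _).comp h

theorem isBoundary_of_disjoint_interior {K L : Set ℍ} (hK : IsHypConvex K) (hKc : IsClosed K)
    (hL : IsHypConvex L) (hLc : IsClosed L)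
    (hLi : (interior L).Nonempty) (hd : Disjoint (interior K) (interior L)) (e : Geod K)
    (he : ∀ x ∈ e.1, x ∈ idealBoundary L) : e.IsBoundary := by
  obtain ⟨x, y, hxy⟩ : ∃ x y, e.1 = s(x, y) := Sym2.ind (fun x y => ⟨x, y, rfl⟩) e.1
  have hne : x ≠ y := fun h => e.2.1 (by rw [hxy, h]; rfl)
  have hx : x ∈ e.1 := hxy ▸ Sym2.mem_mk_left x y
  have hy : y ∈ e.1 := hxy ▸ Sym2.mem_mk_right x y
  obtain ⟨g, rfl, rfl⟩ := exists_circleMap_eq hne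
  have key : ∀ M : Set ℍ, IsHypConvex M → IsClosed M → (∀ x ∈ e.1, x ∈ idealBoundary M) →
      ∀ t, g • axisMap t ∈ M := fun M hM hMc hM' t =>
    (isHypConvex_preimage_smul hM g).imAxis_subset (hMc.preimage (continuous_const_smul g))
      (mem_idealBoundary_preimage_smul.2 (hM' _ hx))
      (mem_idealBoundary_preimage_smul.2 (hM' _ hy)) (axisMap_mem t)
  refine ⟨fun t => g • axisMap t, _, _, (isometry_smul ℍ g).comp isometry_axisMap, fun t => ?_,
    tendsto_toSphere_smul g tendsto_axisMap_atBot, tendsto_toSphere_smul g tendsto_axisMap_atTop,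
    hxy.trans Sym2.eq_swap⟩
  -- The geodesic lies in `L`, hence in the closure of the interior of `L`; a point of it in the
  -- interior of `K` would make the two interiors meet.
  refine ⟨subset_closure (key K hK hKc e.2.2 t), fun hi => ?_⟩
  have := hL.subset_closure_interior hLi (key L hL hLc he t)
  obtain ⟨w, hw1, hw2⟩ := mem_closure_iff.1 this _ isOpen_interior hi
  exact hd.le_bot ⟨hw1, hw2⟩

/-! ### Boundary geodesics -/

theorem interior_preimage_smul (g : SL(2, ℝ)) (K : Set ℍ) :
    interior ((g • ·) ⁻¹' K) = (g • ·) ⁻¹' interior K :=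
  ((Homeomorph.smul g).preimage_interior K).symm

/-- Letting one of three collinear chart points tend to the origin shows that the chart image of `γ`
lies on a line through the origin. If that line were not vertical, `γ` would stay bounded at `-∞`.
-/
theorem re_eq_zero_of_isometry {γ : ℝ → ℍ} (hγ : Isometry γ)
    (h0 : Tendsto (fun t => toSphere (γ t)) atTop (𝓝 (circleToSphere ((0 : ℝ) : OnePoint ℝ))))
    (h1 : Tendsto (fun t => toSphere (γ t)) atBot (𝓝 (circleToSphere ∞))) (t : ℝ) :
    (γ t).re = 0 := by
  have hk0 : Tendsto (fun s => (γ s : ℂ)) atTop (𝓝 0) := by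
    have := OnePoint.isOpenEmbedding_coe.isInducing.tendsto_nhds_iff (f := fun s => (γ s : ℂ))
      (l := atTop) (y := ((0 : ℝ) : ℂ)) |>.2 h0
    rwa [Complex.ofReal_zero] at this
  have hre0 : Tendsto (fun s => (γ s).re) atTop (𝓝 0) :=
    (Complex.continuous_re.tendsto 0).comp hk0
  have him0 : Tendsto (fun s => (γ s).im) atTop (𝓝 0) :=
    (Complex.continuous_im.tendsto 0).comp hk0
  have hcol : ∀ r s, r ≤ s →
      (γ r).re * ((γ s).re ^ 2 + (γ s).im ^ 2) = (γ s).re * ((γ r).re ^ 2 + (γ r).im ^ 2) := by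
    intro r s hrs
    have hev : ∀ᶠ u in atTop,
        ((γ u).re - (γ r).re) * ((γ s).re ^ 2 + (γ s).im ^ 2 - ((γ r).re ^ 2 + (γ r).im ^ 2)) =
        ((γ s).re - (γ r).re) * ((γ u).re ^ 2 + (γ u).im ^ 2 - ((γ r).re ^ 2 + (γ r).im ^ 2)) := by
      filter_upwards [eventually_ge_atTop s] with u hu
      refine klein_collinear_of_dist_add_dist ?_
      rw [hγ.dist_eq, hγ.dist_eq, hγ.dist_eq, Real.dist_eq, Real.dist_eq, Real.dist_eq,
        abs_of_nonpos (by linarith), abs_of_nonpos (by linarith), abs_of_nonpos (by linarith)]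
      ring
    have hL : Tendsto (fun u => ((γ u).re - (γ r).re) *
        ((γ s).re ^ 2 + (γ s).im ^ 2 - ((γ r).re ^ 2 + (γ r).im ^ 2))) atTop
        (𝓝 ((0 - (γ r).re) * ((γ s).re ^ 2 + (γ s).im ^ 2 - ((γ r).re ^ 2 + (γ r).im ^ 2)))) :=
      (hre0.sub_const _).mul_const _
    have hR : Tendsto (fun u => ((γ s).re - (γ r).re) *
        ((γ u).re ^ 2 + (γ u).im ^ 2 - ((γ r).re ^ 2 + (γ r).im ^ 2))) atTop
        (𝓝 (((γ s).re - (γ r).re) * (0 ^ 2 + 0 ^ 2 - ((γ r).re ^ 2 + (γ r).im ^ 2)))) :=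
      (((hre0.pow 2).add (him0.pow 2)).sub_const _).const_mul _
    have := tendsto_nhds_unique_of_eventuallyEq hL hR hev
    linear_combination -this
  obtain ⟨B, hB⟩ : ∃ B, B = (γ t).re ^ 2 + (γ t).im ^ 2 := ⟨_, rfl⟩
  have hB0 : 0 < B := by
    have := (γ t).im_pos
    rw [hB]
    positivity
  by_contra hne
  have hpos : 0 < |(γ t).re| := abs_pos.2 hne
  have hbdd : ∀ r ≤ t, ‖(γ r : ℂ)‖ ≤ B / |(γ t).re| := by
    intro r hr
    have h2 := congrArg abs (hcol r t hr)
    rw [← hB, abs_mul, abs_mul, abs_of_pos hB0] at h2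
    have h3 : (γ r).re ^ 2 + (γ r).im ^ 2 = ‖(γ r : ℂ)‖ ^ 2 := by
      rw [← Complex.normSq_eq_norm_sq, Complex.normSq_apply]
      simp only [coe_re, coe_im]
      ring
    have h4 : 0 < ‖(γ r : ℂ)‖ := norm_pos_iff.2 (γ r).ne_zero
    have h5 : |(γ r).re| ≤ ‖(γ r : ℂ)‖ := Complex.abs_re_le_norm (γ r : ℂ)
    rw [h3, abs_of_nonneg (sq_nonneg ‖(γ r : ℂ)‖)] at h2
    rw [le_div_iff₀ hpos]
    refine le_of_mul_le_mul_right ?_ h4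
    nlinarith
  have ho : IsOpen ((fun z : ℂ => (z : OnePoint ℂ)) '' Metric.closedBall 0 (B / |(γ t).re|))ᶜ :=
    OnePoint.isOpen_compl_image_coe.2 ⟨Metric.isClosed_closedBall, isCompact_closedBall 0 _⟩
  have hev := h1.eventually (ho.mem_nhds (by
    rintro ⟨z, -, hz⟩
    exact OnePoint.coe_ne_infty z hz))
  obtain ⟨r, hr, hrt⟩ := (hev.and (eventually_le_atBot t)).exists
  exact hr ⟨(γ r : ℂ), by simpa using hbdd r hrt, rfl⟩

/-! ### Half-planes cut off by boundary geodesics -/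

theorem isOpenMap_re : IsOpenMap UpperHalfPlane.re :=
  Complex.isOpenMap_re.comp UpperHalfPlane.isOpenEmbedding_coe.isOpenMap

theorem frontier_preimage_re (s : Set ℝ) :
    frontier (UpperHalfPlane.re ⁻¹' s) = UpperHalfPlane.re ⁻¹' frontier s :=
  (isOpenMap_re.preimage_frontier_eq_frontier_preimage UpperHalfPlane.continuous_re s).symm

theorem isPreconnected_preimage_re {s : Set ℝ} (hs : Convex ℝ s) :
    IsPreconnected (UpperHalfPlane.re ⁻¹' s) := by
  refine isOpenEmbedding_klein.isInducing.isPreconnected_image.1 (Convex.isPreconnected ?_)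
  have : klein '' (UpperHalfPlane.re ⁻¹' s) = Prod.fst ⁻¹' s ∩ range klein := by
    rw [inter_comm, ← image_preimage_eq_range_inter]
    rfl
  rw [this]
  exact (hs.linear_preimage (LinearMap.fst ℝ ℝ ℝ)).inter convex_range_klein

/-- A supporting line of the chart image at `klein z` must contain the image of the axis, because
`z` is not an end of it. -/
theorem IsHypConvex.subset_halfPlane {K : Set ℍ} (hK : IsHypConvex K)
    (hi : (interior K).Nonempty) (hA : imAxis ⊆ K) {z : ℍ} (hz : z ∈ imAxis)
    (hzK : z ∉ interior K) :
    Disjoint (UpperHalfPlane.re ⁻¹' Ioi 0) K ∨ Disjoint (UpperHalfPlane.re ⁻¹' Iio 0) K := by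
  rw [mem_interior_iff_klein] at hzK
  obtain ⟨f, hf⟩ := geometric_hahn_banach_open_point hK.convex_image_klein.interior
    isOpen_interior hzK
  have hle : ∀ w ∈ K, f (klein w) ≤ f (klein z) := fun w hw =>
    closure_minimal (fun p hp => (hf p hp).le) (isClosed_le f.continuous continuous_const)
      (hK.klein_mem_closure_interior hi hw)
  have hfk : ∀ w, f (klein w) = w.re * f (1, 0) + (w.re ^ 2 + w.im ^ 2) * f (0, 1) := by
    intro w
    have : klein w = w.re • ((1, 0) : ℝ × ℝ) + (w.re ^ 2 + w.im ^ 2) • ((0, 1) : ℝ × ℝ) := by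
      simp [klein]
    rw [this, map_add, map_smul, map_smul, smul_eq_mul, smul_eq_mul]
  have hz0 : z.re = 0 := hz
  have hfz : ∀ t : ℝ, Real.exp t ^ 2 * f (0, 1) ≤ z.im ^ 2 * f (0, 1) := fun t => by
    have := hle _ (hA (axisMap_mem t))
    rw [hfk, hfk, hz0] at this
    simpa [axisMap] using this
  have hβ : f (0, 1) = 0 := by
    have hp := z.im_pos
    -- Comparing with axis points above and below `z` forces the vertical coefficient of `f` to
    -- vanish.
    have h1 := hfz (Real.log (2 * z.im))
    have h2 := hfz (Real.log (z.im / 2))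
    rw [Real.exp_log (by positivity)] at h1 h2
    nlinarith [sq_nonneg z.im, pow_pos hp 2]
  have hle' : ∀ w ∈ K, w.re * f (1, 0) ≤ 0 := fun w hw => by
    have := hle w hw
    rwa [hfk, hfk, hz0, hβ, mul_zero, mul_zero, zero_mul, add_zero, add_zero] at this
  obtain ⟨w, hw⟩ := hi
  have hlt : w.re * f (1, 0) < 0 := by
    have := hf _ (mem_interior_iff_klein.1 hw)
    rwa [hfk, hfk, hz0, hβ, mul_zero, mul_zero, zero_mul, add_zero, add_zero] at this
  rcases lt_trichotomy (f (1, 0)) 0 with h | h | h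
  · right
    rw [Set.disjoint_left]
    intro v hv hvK
    have hv' : v.re < 0 := hv
    nlinarith [hle' v hvK]
  · rw [h, mul_zero] at hlt
    exact absurd hlt (lt_irrefl _)
  · left
    rw [Set.disjoint_left]
    intro v hv hvK
    have hv' : 0 < v.re := hv
    nlinarith [hle' v hvK]

/-- `H` is the open half-plane beyond the geodesic, on the side away from `K`. The last clause
recovers `e` from `H`, which is what counting needs. -/
theorem Geod.IsBoundary.exists_halfPlane {K : Set ℍ} (hK : IsHypConvex K) (hKc : IsClosed K)
    (hi : (interior K).Nonempty) {e : Geod K} (he : e.IsBoundary) :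
    ∃ H : Set ℍ, IsOpen H ∧ H.Nonempty ∧ IsPreconnected H ∧ Disjoint H K ∧ frontier H ⊆ K ∧
      ∀ x, x ∈ e.1 ↔ x ∈ idealBoundary (frontier H) := by
  obtain ⟨γ, x, y, hγ, hγK, hx, hy, hxy⟩ := he
  have hne : x ≠ y := fun h => e.2.1 (by rw [hxy, h]; rfl)
  obtain ⟨g, rfl, rfl⟩ := exists_circleMap_eq hne
  have hx' := tendsto_toSphere_smul g⁻¹ hx
  have hy' := tendsto_toSphere_smul g⁻¹ hy
  simp only [circleMap, map_inv, inv_smul_smul] at hx' hy'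
  have hre := re_eq_zero_of_isometry ((isometry_smul ℍ g⁻¹).comp hγ) hy' hx' 0
  have hKg : IsHypConvex ((g • ·) ⁻¹' K) := isHypConvex_preimage_smul hK g
  have hKgc : IsClosed ((g • ·) ⁻¹' K) := hKc.preimage (continuous_const_smul g)
  have hint : interior ((g • ·) ⁻¹' K) = (g • ·) ⁻¹' interior K :=
    interior_preimage_smul g K
  have hmem : ∀ t, γ t ∈ K := fun t => hKc.closure_eq ▸ (hγK t).1
  have hA : imAxis ⊆ (g • ·) ⁻¹' K := hKg.imAxis_subset hKgc
    (mem_idealBoundary_preimage_smul.2 (mem_idealBoundary_of_tendsto hx hmem))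
    (mem_idealBoundary_preimage_smul.2 (mem_idealBoundary_of_tendsto hy hmem))
  have key : ∀ s : Set ℝ, IsOpen s → s.Nonempty → Convex ℝ s → frontier s = {0} →
      Disjoint (UpperHalfPlane.re ⁻¹' s) ((g • ·) ⁻¹' K) →
      ∃ H : Set ℍ, IsOpen H ∧ H.Nonempty ∧ IsPreconnected H ∧ Disjoint H K ∧ frontier H ⊆ K ∧
        ∀ x, x ∈ e.1 ↔ x ∈ idealBoundary (frontier H) := by
    intro s hs hsn hsc hsf hd
    have hfr : frontier ((g⁻¹ • ·) ⁻¹' (UpperHalfPlane.re ⁻¹' s)) = (g⁻¹ • ·) ⁻¹' imAxis := by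
      have h1 := (Homeomorph.smul (α := ℍ) g⁻¹).preimage_frontier (UpperHalfPlane.re ⁻¹' s)
      rw [frontier_preimage_re, hsf] at h1
      exact h1.symm
    refine ⟨(g⁻¹ • ·) ⁻¹' (UpperHalfPlane.re ⁻¹' s),
      (hs.preimage UpperHalfPlane.continuous_re).preimage (continuous_const_smul g⁻¹), ?_, ?_, ?_,
      ?_, ?_⟩
    · obtain ⟨a, ha⟩ := hsn
      exact ⟨g • (⟨⟨a, 1⟩, one_pos⟩ : ℍ), by simpa using ha⟩
    · exact ((Homeomorph.smul (α := ℍ) g⁻¹).isPreconnected_preimage).2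
        (isPreconnected_preimage_re hsc)
    · rw [Set.disjoint_left] at hd ⊢
      intro z hz hzK
      exact hd hz (by simpa using hzK)
    · rw [hfr]
      intro z hz
      simpa using hA hz
    · intro u
      rw [hfr, mem_idealBoundary_preimage_smul, mem_idealBoundary_imAxis, hxy, Sym2.mem_iff]
      simp only [circleMap, map_inv, inv_smul_eq_iff]
  rcases hKg.subset_halfPlane (by
      rw [hint]
      obtain ⟨w, hw⟩ := hi
      exact ⟨g⁻¹ • w, by simpa using hw⟩) hA (z := g⁻¹ • γ 0) hre (by
      rw [hint]
      simpa using (hγK 0).2) with h | h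
  · exact key _ isOpen_Ioi nonempty_Ioi (convex_Ioi 0) frontier_Ioi h
  · exact key _ isOpen_Iio nonempty_Iio (convex_Iio 0) frontier_Iio h

theorem subset_of_disjoint_frontier {X : Type*} [TopologicalSpace X] {A B : Set X}
    (hA : IsPreconnected A) (hB : IsOpen B) (hAB : (A ∩ B).Nonempty)
    (hd : Disjoint A (frontier B)) : A ⊆ B := by
  refine hA.subset_left_of_subset_union hB isClosed_closure.isOpen_compl
    (disjoint_compl_right_iff_subset.2 subset_closure) (fun a ha => ?_) hAB
  by_cases h : a ∈ B
  · exact Or.inl h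
  · exact Or.inr fun hc => Set.disjoint_left.1 hd ha ⟨hc, by rwa [hB.interior_eq]⟩

/-- Two of the half-planes are equal or disjoint, since each misses `K` and hence the frontier of
the other. A disjoint family of nonempty open sets in `ℍ` is countable. -/
theorem countable_isBoundary {K : Set ℍ} (hK : IsHypConvex K) (hKc : IsClosed K)
    (hi : (interior K).Nonempty) : {e : Geod K | e.IsBoundary}.Countable := by
  choose! H ho hn hp hd hf hb using
    fun (e : Geod K) (he : e.IsBoundary) => he.exists_halfPlane hK hKc hi
  refine Set.PairwiseDisjoint.countable_of_isOpen (s := H) ?_ ho hn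
  intro e he e' he' hne
  by_contra hnd
  obtain ⟨w, hw⟩ := Set.not_disjoint_iff_nonempty_inter.1 hnd
  have hHH : H e = H e' := subset_antisymm
    (subset_of_disjoint_frontier (hp e he) (ho e' he') ⟨w, hw⟩
      ((hd e he).mono_right (hf e' he')))
    (subset_of_disjoint_frontier (hp e' he') (ho e he) ⟨w, hw.symm⟩
      ((hd e' he').mono_right (hf e he)))
  exact hne (Subtype.ext (Sym2.ext fun x => by rw [hb e he, hb e' he', hHH]))

/-- The imaginary part of the fixed point equation, divided by `im`, is affine in `re`; two points
with different real parts make `g` scalar. -/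
theorem smul_eq_of_smul_eq_on_open {g : SL(2, ℝ)} {U : Set ℍ} (hU : IsOpen U) (hn : U.Nonempty)
    (h : ∀ z ∈ U, g • z = z) (z : ℍ) : g • z = z := by
  have hdet : g 0 0 * g 1 1 - g 0 1 * g 1 0 = 1 := by
    have := g.det_coe
    rwa [Matrix.det_fin_two] at this
  have hiff : ∀ w : ℍ, g • w = w ↔
      (g 0 0 : ℂ) * w + (g 0 1 : ℂ) = w * ((g 1 0 : ℂ) * w + (g 1 1 : ℂ)) := fun w => by
    have hd : (g 1 0 : ℂ) * w + (g 1 1 : ℂ) ≠ 0 :=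
      denom_ne_zero (Matrix.SpecialLinearGroup.toGL g) w
    rw [UpperHalfPlane.ext_iff, coe_specialLinearGroup_apply]
    exact div_eq_iff hd
  have him : ∀ w ∈ U, g 0 0 = 2 * g 1 0 * w.re + g 1 1 := fun w hw => by
    have h1 := congrArg Complex.im ((hiff w).1 (h w hw))
    simp at h1
    refine mul_right_cancel₀ w.im_pos.ne' ?_
    linear_combination h1
  obtain ⟨w, hw⟩ := hn
  obtain ⟨ε, hε, hball⟩ := Metric.isOpen_iff.1 (isOpenMap_re U hU) _ (mem_image_of_mem _ hw)
  obtain ⟨w', hw', hre⟩ := hball (show w.re + ε / 2 ∈ Metric.ball w.re ε by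
    rw [Metric.mem_ball, Real.dist_eq, add_sub_cancel_left, abs_of_pos (half_pos hε)]
    exact half_lt_self hε)
  have h1 := him w hw
  have h2 := him w' hw'
  have h10 : g 1 0 = 0 := by
    rw [hre] at h2
    have : g 1 0 * ε = 0 := by linear_combination h1 - h2
    exact (mul_eq_zero.1 this).resolve_right hε.ne'
  have h00 : g 0 0 = g 1 1 := by rw [h1, h10]; ring
  have h01 : g 0 1 = 0 := by
    have h3 := congrArg Complex.re ((hiff w).1 (h w hw))
    simpa [h10, h00, mul_comm] using h3
  rw [hiff, h10, h00, h01]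
  push_cast
  ring

theorem smul_eq_smul_of_eq_on_open {g g' : SL(2, ℝ)} {U : Set ℍ} (hU : IsOpen U)
    (hn : U.Nonempty) (h : ∀ z ∈ U, g • z = g' • z) (z : ℍ) : g • z = g' • z := by
  rw [← inv_smul_eq_iff, ← mul_smul]
  exact smul_eq_of_smul_eq_on_open hU hn (fun w hw => by rw [mul_smul, h w hw, inv_smul_smul]) z

/-! ### The topology of the space of geodesics -/

theorem continuous_circleToSphere : Continuous circleToSphere := by
  refine OnePoint.continuous_map Complex.continuous_ofReal ?_
  rw [coclosedCompact_eq_cocompact, coclosedCompact_eq_cocompact]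
  exact Complex.isometry_ofReal.isClosedEmbedding.tendsto_cocompact

theorem circleToSphere_injective : Function.Injective circleToSphere := by
  refine Option.map_injective Complex.ofReal_injective

theorem isClosed_idealBoundary (K : Set ℍ) : IsClosed (idealBoundary K) :=
  isClosed_closure.preimage continuous_circleToSphere

theorem continuous_circleMap (g : SL(2, ℝ)) : Continuous (circleMap g) := by
  rw [(continuous_circleToSphere.isClosedEmbedding circleToSphere_injective).continuous_iff]
  have : circleToSphere ∘ circleMap g =
      (fun x => ((Matrix.SpecialLinearGroup.toGL g).map Complex.ofRealHom) • x) ∘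
        circleToSphere := by
    funext x
    exact OnePoint.map_smul _ _ _
  rw [this]
  exact (continuous_moebius _).comp continuous_circleToSphere

instance : SecondCountableTopology (OnePoint ℝ) :=
  (onePointEquivSphereOfFinrankEq (ι := Fin 2) (V := ℝ) (by simp)).isEmbedding
    |>.secondCountableTopology

section Sym2

variable {X Y : Type*} [TopologicalSpace X] [TopologicalSpace Y]

theorem isQuotientMap_sym2Mk : IsQuotientMap fun p : X × X => s(p.1, p.2) :=
  ⟨⟨rfl⟩, Sym2.mk_surjective⟩

theorem isOpenQuotientMap_sym2Mk : IsOpenQuotientMap fun p : X × X => s(p.1, p.2) := by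
  refine ⟨Sym2.mk_surjective, isQuotientMap_sym2Mk.continuous, fun U hU => ?_⟩
  rw [← isQuotientMap_sym2Mk.isOpen_preimage]
  have : (fun p : X × X => s(p.1, p.2)) ⁻¹' ((fun p : X × X => s(p.1, p.2)) '' U) =
      U ∪ Prod.swap ⁻¹' U := by
    ext ⟨a, b⟩
    constructor
    · rintro ⟨⟨c, d⟩, hU, h⟩
      rcases Sym2.eq_iff.1 h with ⟨rfl, rfl⟩ | ⟨rfl, rfl⟩
      · exact Or.inl hU
      · exact Or.inr hU
    · rintro (h | h)
      · exact ⟨_, h, rfl⟩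
      · exact ⟨_, h, Sym2.eq_swap⟩
  rw [this]
  exact hU.union (hU.preimage continuous_swap)

instance [SecondCountableTopology X] : SecondCountableTopology (Sym2 X) :=
  isOpenQuotientMap_sym2Mk.isQuotientMap.secondCountableTopology
    isOpenQuotientMap_sym2Mk.isOpenMap

instance [CompactSpace X] : CompactSpace (Sym2 X) :=
  Sym2.mk_surjective.compactSpace isQuotientMap_sym2Mk.continuous

instance [T2Space X] : T2Space (Sym2 X) := by
  rw [t2Space_iff_of_isOpenQuotientMap isOpenQuotientMap_sym2Mk]
  have : {q : (X × X) × (X × X) | s(q.1.1, q.1.2) = s(q.2.1, q.2.2)} =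
      {q | q.1 = q.2} ∪ {q | q.1 = q.2.swap} := by
    ext ⟨⟨a, b⟩, ⟨c, d⟩⟩
    simp
  rw [this]
  exact (isClosed_eq (by fun_prop) (by fun_prop)).union
    (isClosed_eq (by fun_prop) (by fun_prop))

theorem continuous_sym2Map {f : X → Y} (hf : Continuous f) : Continuous (Sym2.map f) :=
  isQuotientMap_sym2Mk.continuous_iff.2
    (isQuotientMap_sym2Mk.continuous.comp (hf.prodMap hf))

theorem isOpen_setOf_not_isDiag [T2Space X] : IsOpen {e : Sym2 X | ¬ e.IsDiag} := by
  rw [← isQuotientMap_sym2Mk.isOpen_preimage]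
  exact (isClosed_diagonal (X := X)).isOpen_compl

theorem isClosed_setOf_forall_mem {C : Set X} (hC : IsClosed C) :
    IsClosed {e : Sym2 X | ∀ x ∈ e, x ∈ C} := by
  rw [← isQuotientMap_sym2Mk.isClosed_preimage]
  have : (fun p : X × X => s(p.1, p.2)) ⁻¹' {e : Sym2 X | ∀ x ∈ e, x ∈ C} = C ×ˢ C := by
    ext ⟨a, b⟩
    simp
  rw [this]
  exact hC.prod hC

end Sym2

namespace Geod

variable {K L M : Set ℍ}

theorem isEmbedding_val : IsEmbedding (Subtype.val : Geod K → Sym2 (OnePoint ℝ)) :=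
  IsEmbedding.subtypeVal

instance : T2Space (Geod K) := isEmbedding_val.t2Space

instance : SecondCountableTopology (Geod K) := isEmbedding_val.secondCountableTopology

instance : LocallyCompactSpace (Geod K) := by
  have h : IsLocallyClosed
      {e : Sym2 (OnePoint ℝ) | ¬ e.IsDiag ∧ ∀ x ∈ e, x ∈ idealBoundary K} :=
    isOpen_setOf_not_isDiag.isLocallyClosed.inter
      (isClosed_setOf_forall_mem (isClosed_idealBoundary K)).isLocallyClosed
  exact h.locallyCompactSpace

theorem map_map (g g' : SL(2, ℝ)) (h : ∀ z ∈ K, g • z ∈ L) (h' : ∀ z ∈ L, g' • z ∈ M)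
    (h'' : ∀ z ∈ K, (g' * g) • z ∈ M) (e : Geod K) : map g' h' (map g h e) = map (g' * g) h'' e := by
  apply Subtype.ext
  change Sym2.map _ (Sym2.map _ e.1) = Sym2.map _ e.1
  rw [Sym2.map_map]
  congr 1
  funext x
  simp [circleMap, mul_smul]

theorem map_congr {g g' : SL(2, ℝ)} (h : ∀ z ∈ K, g • z ∈ L) (h' : ∀ z ∈ K, g' • z ∈ L)
    (hg : ∀ x, circleMap g x = circleMap g' x) : map g h = map g' h' := by
  funext e
  apply Subtype.ext
  change Sym2.map _ e.1 = Sym2.map _ e.1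
  rw [funext hg]

theorem map_injective (g : SL(2, ℝ)) (h : ∀ z ∈ K, g • z ∈ L) :
    Function.Injective (map g h) := fun _ _ he =>
  Subtype.ext (Sym2.map.injective (circleMap_injective g) (congrArg Subtype.val he))

theorem range_map (g : SL(2, ℝ)) (h : ∀ z ∈ K, g • z ∈ L) :
    range (map g h) = {e | ∀ x ∈ e.1, x ∈ idealBoundary ((g⁻¹ • ·) ⁻¹' K)} := by
  have hinv : Sym2.map (circleMap g) ∘ Sym2.map (circleMap g⁻¹) = id := by
    rw [← Sym2.map_comp, ← Sym2.map_id]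
    congr 1
    funext x
    simp [circleMap]
  ext e
  constructor
  · rintro ⟨e', rfl⟩ x hx
    obtain ⟨y, hy, rfl⟩ := Sym2.mem_map.1 hx
    rw [mem_idealBoundary_preimage_smul]
    simpa [circleMap] using e'.2.2 y hy
  · intro he
    refine ⟨⟨Sym2.map (circleMap g⁻¹) e.1, fun hd => e.2.1
      ((Sym2.isDiag_map (circleMap_injective g⁻¹)).1 hd), fun x hx => ?_⟩, ?_⟩
    · obtain ⟨y, hy, rfl⟩ := Sym2.mem_map.1 hx
      exact mem_idealBoundary_preimage_smul.1 (he y hy)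
    · exact Subtype.ext (congrFun hinv e.1)

/-- Through this, images of Borel sets of geodesics are Borel, and measures can be pulled back along
the map. -/
theorem isClosedEmbedding_map (g : SL(2, ℝ)) (h : ∀ z ∈ K, g • z ∈ L) :
    IsClosedEmbedding (map g h) := by
  refine ⟨IsEmbedding.of_comp ?_ isEmbedding_val.continuous ?_, ?_⟩
  · exact isEmbedding_val.continuous_iff.2
      ((continuous_sym2Map (continuous_circleMap g)).comp isEmbedding_val.continuous)
  · exact ((continuous_sym2Map (continuous_circleMap g)).isClosedEmbedding
      (Sym2.map.injective (circleMap_injective g))).isEmbedding.comp isEmbedding_val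
  · rw [range_map]
    exact (isClosed_setOf_forall_mem (isClosed_idealBoundary _)).preimage
      isEmbedding_val.continuous

theorem measurableEmbedding_map (g : SL(2, ℝ)) (h : ∀ z ∈ K, g • z ∈ L) :
    MeasurableEmbedding (map g h) := (isClosedEmbedding_map g h).measurableEmbedding

theorem IsBoundary.map {g : SL(2, ℝ)} (h : ∀ z, g • z ∈ L ↔ z ∈ K) {e : Geod K}
    (he : e.IsBoundary) : (Geod.map g (fun z => (h z).2) e).IsBoundary := by
  obtain ⟨γ, x, y, hγ, hγK, hx, hy, hxy⟩ := he
  have hK : (g • ·) ⁻¹' L = K := Set.ext h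
  have hfr : (g • ·) ⁻¹' frontier L = frontier K := by
    rw [← hK]
    exact (Homeomorph.smul (α := ℍ) g).preimage_frontier L
  refine ⟨fun t => g • γ t, _, _, (isometry_smul ℍ g).comp hγ, fun t => ?_,
    tendsto_toSphere_smul g hx, tendsto_toSphere_smul g hy, ?_⟩
  · have := hγK t
    rwa [← hfr] at this
  · change Sym2.map _ e.1 = _
    rw [hxy]
    rfl

end Geod

/-! ### Deck transformations -/

namespace HyperbolicSurface

variable {S : Type*} [TopologicalSpace S] (h : HyperbolicSurface S)

theorem isHypConvex_cover : IsHypConvex h.cover := h.convex_cover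

theorem preconnectedSpace_cover : PreconnectedSpace h.cover :=
  Subtype.preconnectedSpace h.isHypConvex_cover.isPreconnected

/-- Geometry determines a matrix only through its action, hence up to sign; membership in `deck` is
insensitive to this. -/
theorem mem_deck_of_smul_eq {g g' : SL(2, ℝ)} (hg : g ∈ h.deck)
    (hgg' : ∀ z : ℍ, g' • z = g • z) : g' ∈ h.deck := by
  refine ⟨fun u => by rw [hgg', hg.1], fun u => ?_⟩
  rw [← hg.2 u]
  congr 2
  exact hgg' _

theorem exists_mem_deck {z w : h.cover} (hzw : h.proj z = h.proj w) :
    ∃ g ∈ h.deck, g • (z : ℍ) = w := by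
  obtain ⟨g, hg, hg', hgz⟩ := h.exists_deck z w hzw
  exact ⟨g, ⟨hg, hg'⟩, hgz⟩

/-- Uniqueness of lifts gives equality on the connected cover, and rigidity extends it from the
interior to `ℍ`. -/
theorem smul_eq_smul_of_mem_deck {g g' : SL(2, ℝ)} (hg : g ∈ h.deck) (hg' : g' ∈ h.deck) {z : ℍ}
    (hz : z ∈ h.cover) (hgg' : g • z = g' • z) (w : ℍ) : g • w = g' • w := by
  have := h.preconnectedSpace_cover
  have key := h.isCoveringMap_proj.eq_of_comp_eq
    (g₁ := fun u : h.cover => ⟨g • (u : ℍ), (hg.1 u).2 u.2⟩)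
    (g₂ := fun u : h.cover => ⟨g' • (u : ℍ), (hg'.1 u).2 u.2⟩)
    (((continuous_const_smul g).comp continuous_subtype_val).subtype_mk _)
    (((continuous_const_smul g').comp continuous_subtype_val).subtype_mk _)
    (funext fun u => (hg.2 u).trans (hg'.2 u).symm) ⟨z, hz⟩ (Subtype.ext hgg')
  exact smul_eq_smul_of_eq_on_open isOpen_interior h.nonempty_interior
    (fun u hu => congrArg Subtype.val (congrFun key ⟨u, interior_subset hu⟩)) w

theorem proj_notMem_boundary {z : h.cover} (hz : (z : ℍ) ∈ interior h.cover) :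
    h.proj z ∉ h.boundary := by
  rintro ⟨w, hw, hwz⟩
  obtain ⟨g, hg, hgw⟩ := h.exists_mem_deck hwz
  have hint : (g • ·) ⁻¹' interior h.cover = interior h.cover := by
    rw [← interior_preimage_smul]
    congr 1
    exact Set.ext hg.1
  refine hw.2 ?_
  rw [← hint, mem_preimage, hgw]
  exact hz

end HyperbolicSurface

/-! ### Translates of the lifted components and their pieces -/

namespace GeodesicRealization

variable {S : Type*} [TopologicalSpace S] {hS : HyperbolicSurface S}
  {ι : Type*} {R : ι → Type*} [∀ i, TopologicalSpace (R i)] {hR : ∀ i, HyperbolicSurface (R i)}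
  (I : GeodesicRealization hS hR)

/-- Choose a deck transformation `m` of `S` such that `m ∘ lift` and `lift ∘ k` agree at one point.
Both lift the same map to `S`, so they agree on the cover of `R i`. -/
theorem conj_mem_deck {i : ι} {k : SL(2, ℝ)} (hk : k ∈ (hR i).deck) :
    I.lift i * k * (I.lift i)⁻¹ ∈ hS.deck := by
  obtain ⟨z, hz⟩ := (hR i).nonempty_interior
  have hzc := interior_subset hz
  have hproj : ∀ u : (hR i).cover,
      hS.proj ⟨I.lift i • k • (u : ℍ), I.lift_mem i _ ((hk.1 u).2 u.2)⟩ =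
        hS.proj ⟨I.lift i • (u : ℍ), I.lift_mem i u u.2⟩ := fun u => by
    rw [I.proj_lift i u, I.proj_lift i ⟨k • (u : ℍ), (hk.1 u).2 u.2⟩, hk.2 u]
  obtain ⟨m, hm, hmz⟩ := hS.exists_mem_deck (hproj ⟨z, hzc⟩).symm
  have := (hR i).preconnectedSpace_cover
  have key := hS.isCoveringMap_proj.eq_of_comp_eq
    (g₁ := fun u : (hR i).cover =>
      ⟨m • I.lift i • (u : ℍ), (hm.1 _).2 (I.lift_mem i u u.2)⟩)
    (g₂ := fun u : (hR i).cover =>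
      ⟨I.lift i • k • (u : ℍ), I.lift_mem i _ ((hk.1 u).2 u.2)⟩)
    (((continuous_const_smul m).comp
      ((continuous_const_smul (I.lift i)).comp continuous_subtype_val)).subtype_mk _)
    (((continuous_const_smul (I.lift i)).comp
      ((continuous_const_smul k).comp continuous_subtype_val)).subtype_mk _)
    (funext fun u => (hm.2 ⟨_, I.lift_mem i u u.2⟩).trans (hproj u).symm) ⟨z, hzc⟩
    (Subtype.ext hmz)
  have hall : ∀ u : ℍ, (m * I.lift i) • u = (I.lift i * k) • u := fun u => by
    refine smul_eq_smul_of_eq_on_open isOpen_interior (hR i).nonempty_interior (fun v hv => ?_) u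
    rw [mul_smul, mul_smul]
    exact congrArg Subtype.val (congrFun key ⟨v, interior_subset hv⟩)
  refine hS.mem_deck_of_smul_eq hm fun u => ?_
  rw [mul_smul, ← hall, mul_smul, smul_inv_smul]

/-- Injectivity of the realization on the interior identifies the projections of `z` and `w`, so
some `k` in the deck group of `R i` carries `z` to `w`. Then `g` acts as `g'` times the conjugate of
`k`. -/
theorem sigma_coset_eq {i j : ι} {g g' : hS.deck} {z w : ℍ} (hz : z ∈ interior (hR i).cover)
    (hw : w ∈ interior (hR j).cover)
    (hzw : ((g : SL(2, ℝ)) * I.lift i) • z = ((g' : SL(2, ℝ)) * I.lift j) • w) :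
    (⟨i, (g : hS.deck ⧸ I.imageDeck i)⟩ : Σ i, hS.deck ⧸ I.imageDeck i) =
      ⟨j, (g' : hS.deck ⧸ I.imageDeck j)⟩ := by
  have hzc := interior_subset hz
  have hwc := interior_subset hw
  rw [mul_smul, mul_smul] at hzw
  have h1 := g.2.2 ⟨_, I.lift_mem i z hzc⟩
  have h2 := g'.2.2 ⟨_, I.lift_mem j w hwc⟩
  rw [I.proj_lift i ⟨z, hzc⟩] at h1
  rw [I.proj_lift j ⟨w, hwc⟩] at h2
  have h3 : I.toFun ⟨i, (hR i).proj ⟨z, hzc⟩⟩ = I.toFun ⟨j, (hR j).proj ⟨w, hwc⟩⟩ := by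
    rw [← h1, ← h2]
    congr 2
  have h4 := congrArg Subtype.val (I.isEmbedding_interior.injective
    (a₁ := ⟨⟨i, (hR i).proj ⟨z, hzc⟩⟩, (hR i).proj_notMem_boundary hz⟩)
    (a₂ := ⟨⟨j, (hR j).proj ⟨w, hwc⟩⟩, (hR j).proj_notMem_boundary hw⟩) h3)
  obtain rfl : i = j := congrArg Sigma.fst h4
  obtain ⟨k, hk, hkz⟩ := (hR i).exists_mem_deck (eq_of_heq (Sigma.mk.inj h4).2)
  have hm := I.conj_mem_deck hk
  have h5 := hS.smul_eq_smul_of_mem_deck g.2 (hS.deck.mul_mem g'.2 hm) (I.lift_mem i z hzc) (by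
    rw [mul_smul, mul_smul, mul_smul, inv_smul_smul, hzw]
    exact congrArg (fun u => (g' : SL(2, ℝ)) • I.lift i • u) hkz.symm)
  congr 1
  rw [QuotientGroup.eq, imageDeck, Subgroup.mem_subgroupOf, Subgroup.mem_map]
  -- This matrix acts as `k⁻¹` but may differ from it by a sign.
  refine ⟨(I.lift i)⁻¹ * ((g : SL(2, ℝ))⁻¹ * g') * I.lift i,
    (hR i).mem_deck_of_smul_eq ((hR i).deck.inv_mem hk) fun u => ?_, ?_⟩
  · have h6 := h5 (I.lift i • k⁻¹ • u)
    simp only [mul_smul, inv_smul_smul, smul_inv_smul] at h6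
    simp only [mul_smul]
    rw [← h6, inv_smul_smul, inv_smul_smul]
  · simp [mul_assoc]

/-- The matrix of the chosen representative of a translate of a lift of a component. -/
def translate (q : Σ i, hS.deck ⧸ I.imageDeck i) : SL(2, ℝ) :=
  (q.2.out : SL(2, ℝ)) * I.lift q.1

theorem translate_mem (q : Σ i, hS.deck ⧸ I.imageDeck i) :
    ∀ z ∈ (hR q.1).cover, I.translate q • z ∈ hS.cover := I.smul_lift_mem q.1 q.2.out

theorem eq_of_translate_smul_eq {q q' : Σ i, hS.deck ⧸ I.imageDeck i} {z w : ℍ}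
    (hz : z ∈ interior (hR q.1).cover) (hw : w ∈ interior (hR q'.1).cover)
    (hzw : I.translate q • z = I.translate q' • w) : q = q' := by
  have := I.sigma_coset_eq hz hw hzw
  simpa using this

theorem countable_translates : Countable (Σ i, hS.deck ⧸ I.imageDeck i) := by
  refine Pairwise.countable_of_isOpen_disjoint (α := ℍ)
    (s := fun q => ((I.translate q)⁻¹ • ·) ⁻¹' interior (hR q.1).cover) ?_
    (fun q => isOpen_interior.preimage (continuous_const_smul _)) (fun q => ?_)
  · intro q q' hqq'
    rw [Function.onFun, Set.disjoint_left]
    exact fun z hz hz' => hqq' (I.eq_of_translate_smul_eq hz hz' (by simp))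
  · obtain ⟨z, hz⟩ := (hR q.1).nonempty_interior
    exact ⟨I.translate q • z, by simpa using hz⟩

/-- The geodesics of `S` that are lifts of interior geodesics of the surface `R i` in a given
translate of its universal cover. -/
def piece (q : Σ i, hS.deck ⧸ I.imageDeck i) : Set (Geod hS.cover) :=
  Geod.map (I.translate q) (I.translate_mem q) '' {e | ¬ e.IsBoundary}

theorem pairwise_disjoint_piece : Pairwise (Function.onFun Disjoint I.piece) := by
  intro q q' hqq'
  rw [Function.onFun, Set.disjoint_left]
  rintro _ ⟨e, he, rfl⟩ ⟨e', -, hee'⟩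
  -- Here `L` is the other translate seen in the coordinates of the cover of `R q.1`.
  refine he (isBoundary_of_disjoint_interior (hR q.1).isHypConvex_cover
    (hR q.1).isClosed_cover (L := (((I.translate q')⁻¹ * I.translate q) • ·) ⁻¹' (hR q'.1).cover)
    (isHypConvex_preimage_smul (hR q'.1).isHypConvex_cover _)
    ((hR q'.1).isClosed_cover.preimage (continuous_const_smul _)) ?_ ?_ e ?_)
  · rw [interior_preimage_smul]
    obtain ⟨z, hz⟩ := (hR q'.1).nonempty_interior
    exact ⟨((I.translate q')⁻¹ * I.translate q)⁻¹ • z, by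
      simpa only [mem_preimage, smul_inv_smul] using hz⟩
  · rw [interior_preimage_smul, Set.disjoint_left]
    intro z hz hz'
    refine hqq' (I.eq_of_translate_smul_eq hz hz' ?_)
    simp [mul_smul]
  · intro x hx
    rw [mem_idealBoundary_preimage_smul]
    have h1 : circleMap (I.translate q) x ∈
        (Geod.map (I.translate q') (I.translate_mem q') e').1 := by
      rw [hee']
      exact Sym2.mem_map.2 ⟨x, hx, rfl⟩
    obtain ⟨y, hy, hyx⟩ := Sym2.mem_map.1 h1
    have h2 : circleMap ((I.translate q')⁻¹ * I.translate q) x = y := by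
      have := congrArg (circleMap (I.translate q')⁻¹) hyx
      simpa [circleMap, mul_smul] using this.symm
    rw [h2]
    exact e'.2.2 y hy

end GeodesicRealization

/-! ### Measurability of the mass of a Borel set -/

/-- Bump functions equal to 1 on the members of a compact exhaustion of `U`. The sequence does not
depend on the measure, so the mass of `U` is a countable supremum of Borel functions of the current.
-/
theorem exists_seq_tendsto_mass {X : Type*} [TopologicalSpace X] [T2Space X]
    [LocallyCompactSpace X] [SecondCountableTopology X] [MeasurableSpace X] [BorelSpace X]
    {U : Set X} (hU : IsOpen U) :
    ∃ f : ℕ → {f : X → ℝ // Continuous f ∧ HasCompactSupport f},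
      ∀ (μ : Measure X) [IsLocallyFiniteMeasure μ],
        μ U = ⨆ n, ENNReal.ofReal (∫ x, (f n).1 x ∂μ) := by
  have : LocallyCompactSpace U := hU.locallyCompactSpace
  obtain ⟨E⟩ : Nonempty (CompactExhaustion U) := inferInstance
  have hK : ∀ n, IsCompact (Subtype.val '' E n) := fun n =>
    (E.isCompact n).image continuous_subtype_val
  have hKU : ∀ n, Subtype.val '' E n ⊆ U := fun n => by
    rintro _ ⟨x, -, rfl⟩
    exact x.2
  choose f hf1 hf2 hf3 hf4 using fun n =>
    exists_continuousMap_one_of_isCompact_subset_isOpen (hK n) hU (hKU n)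
  refine ⟨fun n => ⟨f n, (f n).continuous, hf2 n⟩, fun μ _ => le_antisymm ?_ (iSup_le fun n => ?_)⟩
  · have hUn : U = ⋃ n, Subtype.val '' E n := by
      rw [← image_iUnion, E.iUnion_eq, image_univ, Subtype.range_coe]
    have hm : Monotone fun n => (Subtype.val '' E n : Set X) := fun m n hmn =>
      image_mono (E.subset hmn)
    rw [hUn, hm.measure_iUnion]
    refine iSup_mono fun n => ?_
    rw [ofReal_integral_eq_lintegral_ofReal ((f n).continuous.integrable_of_hasCompactSupport
      (hf2 n)) (Eventually.of_forall fun x => (hf4 n x).1),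
      ← lintegral_indicator_one (hK n).measurableSet]
    refine lintegral_mono fun x => ?_
    by_cases hx : x ∈ (Subtype.val '' E n : Set X)
    · rw [indicator_of_mem hx, hf1 n hx]
      simp
    · rw [indicator_of_notMem hx]
      exact zero_le
  · rw [ofReal_integral_eq_lintegral_ofReal ((f n).continuous.integrable_of_hasCompactSupport
      (hf2 n)) (Eventually.of_forall fun x => (hf4 n x).1),
      ← lintegral_indicator_one hU.measurableSet]
    refine lintegral_mono fun x => ?_
    by_cases hx : x ∈ U
    · rw [indicator_of_mem hx]
      exact ENNReal.ofReal_le_one.2 (hf4 n x).2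
    · rw [image_eq_zero_of_notMem_tsupport fun h => hx (hf3 n h)]
      simp

namespace HyperbolicSurface

variable {S : Type*} [TopologicalSpace S] (h : HyperbolicSurface S)

instance (c : h.Current) : IsLocallyFiniteMeasure c.measure := c.isLocallyFinite

theorem continuous_integral (f : {f : Geod h.cover → ℝ // Continuous f ∧ HasCompactSupport f}) :
    Continuous fun c : h.Current => ∫ e, f.1 e ∂c.measure :=
  continuous_iff_le_induced.2 (iInf_le _ f)

theorem measurable_measure_of_isOpen {U : Set (Geod h.cover)} (hU : IsOpen U) :
    Measurable fun c : h.Current => c.measure U := by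
  obtain ⟨f, hf⟩ := exists_seq_tendsto_mass hU
  simp only [hf]
  exact .iSup fun n => (h.continuous_integral (f n)).measurable.ennreal_ofReal

theorem measurable_measure {B : Set (Geod h.cover)} (hB : MeasurableSet B) :
    Measurable fun c : h.Current => c.measure B := by
  obtain ⟨E⟩ : Nonempty (CompactExhaustion (Geod h.cover)) := inferInstance
  have hmono : Monotone fun n => B ∩ interior (E n) := fun m n hmn =>
    inter_subset_inter_right _ (interior_mono (E.subset hmn))
  have hUn : B = ⋃ n, B ∩ interior (E n) := by
    rw [← inter_iUnion, eq_comm, inter_eq_left]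
    intro e _
    obtain ⟨n, hn⟩ := E.exists_mem_nhds e
    exact mem_iUnion.2 ⟨n, mem_interior_iff_mem_nhds.2 hn⟩
  -- Currents may have infinite mass, so the π-system argument is run on their finite restrictions
  -- to relatively compact open sets.
  have hn : ∀ n, Measurable fun c : h.Current => c.measure (B ∩ interior (E n)) := fun n => by
    have hfin : ∀ c : h.Current, IsFiniteMeasure (c.measure.restrict (interior (E n))) :=
      fun c => ⟨by
        rw [Measure.restrict_apply_univ]
        exact (measure_mono interior_subset).trans_lt (E.isCompact n).measure_lt_top⟩
    have hr : Measurable fun c : h.Current => c.measure.restrict (interior (E n)) := by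
      refine Measurable.measure_of_isPiSystem (BorelSpace.measurable_eq (α := Geod h.cover))
        isPiSystem_isOpen (fun s hs => ?_) ?_
      · have hs' : IsOpen s := hs
        simp only [Measure.restrict_apply hs'.measurableSet]
        exact h.measurable_measure_of_isOpen (hs'.inter isOpen_interior)
      · simp only [Measure.restrict_apply_univ]
        exact h.measurable_measure_of_isOpen isOpen_interior
    simpa only [Function.comp_def, Measure.restrict_apply hB] using
      (Measure.measurable_coe hB).comp hr
  have heq : (fun c : h.Current => c.measure B) =
      fun c : h.Current => ⨆ n, c.measure (B ∩ interior (E n)) := by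
    funext c
    conv_lhs => rw [hUn]
    exact hmono.measure_iUnion
  rw [heq]
  exact .iSup hn

end HyperbolicSurface

/-! ### Push-forward and restriction of currents -/

theorem HyperbolicSurface.countable_isBoundary {S : Type*} [TopologicalSpace S]
    (h : HyperbolicSurface S) : {e : Geod h.cover | e.IsBoundary}.Countable :=
  SurfaceCurrents.countable_isBoundary h.isHypConvex_cover h.isClosed_cover h.nonempty_interior

theorem HyperbolicSurface.measurableSet_not_isBoundary {S : Type*} [TopologicalSpace S]
    (h : HyperbolicSurface S) : MeasurableSet {e : Geod h.cover | ¬ e.IsBoundary} :=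
  h.countable_isBoundary.measurableSet.compl

theorem HyperbolicSurface.Current.measure_image {S : Type*} [TopologicalSpace S]
    {h : HyperbolicSurface S} (c : h.Current) {g : SL(2, ℝ)} (hg : g ∈ h.deck)
    (A : Set (Geod h.cover)) :
    c.measure (Geod.map g (h.smul_mem_cover hg) '' A) = c.measure A := by
  conv_lhs => rw [← c.invariant g hg]
  rw [(Geod.measurableEmbedding_map _ _).map_apply,
    preimage_image_eq _ (Geod.map_injective _ _)]

namespace GeodesicRealization

variable {S : Type*} [TopologicalSpace S] {hS : HyperbolicSurface S}
  {ι : Type*} {R : ι → Type*} [∀ i, TopologicalSpace (R i)] {hR : ∀ i, HyperbolicSurface (R i)}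
  (I : GeodesicRealization hS hR)

theorem push_apply (c : ∀ i, (hR i).Current) {A : Set (Geod hS.cover)} (hA : MeasurableSet A) :
    I.push c A = ∑' q : Σ i, hS.deck ⧸ I.imageDeck i,
      (c q.1).measure (Geod.map (I.translate q) (I.translate_mem q) ⁻¹' A) := by
  rw [push, Measure.sum_apply _ hA, ENNReal.tsum_sigma']
  refine tsum_congr fun i => ?_
  rw [pushComponent, Measure.sum_apply _ hA]
  refine tsum_congr fun q => ?_
  rw [(Geod.measurableEmbedding_map _ _).map_apply]
  rfl

/-- The part of a current of `S` that is carried by the interior geodesics of the component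
`R i`, as a measure. -/
def restrictMeasure (c : hS.Current) (i : ι) : Measure (Geod (hR i).cover) :=
  (c.measure.comap (Geod.map (I.lift i) (I.lift_mem i))).restrict {e | ¬ e.IsBoundary}

theorem restrictMeasure_apply (c : hS.Current) (i : ι) {s : Set (Geod (hR i).cover)}
    (hs : MeasurableSet s) : I.restrictMeasure c i s =
      c.measure (Geod.map (I.lift i) (I.lift_mem i) '' (s ∩ {e | ¬ e.IsBoundary})) := by
  rw [restrictMeasure, Measure.restrict_apply hs, (Geod.measurableEmbedding_map _ _).comap_apply]

theorem isLocallyFiniteMeasure_restrictMeasure (c : hS.Current) (i : ι) :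
    IsLocallyFiniteMeasure (I.restrictMeasure c i) := by
  refine ⟨fun e => ?_⟩
  obtain ⟨U, heU, hU, hUc⟩ := c.measure.exists_isOpen_measure_lt_top
    (Geod.map (I.lift i) (I.lift_mem i) e)
  have ho := hU.preimage (Geod.isClosedEmbedding_map (I.lift i) (I.lift_mem i)).continuous
  refine ⟨_, ho.mem_nhds heU, ?_⟩
  rw [I.restrictMeasure_apply c i ho.measurableSet]
  refine (measure_mono ?_).trans_lt hUc
  rintro _ ⟨e', he', rfl⟩
  exact he'.1

/-- Deck transformations permute the non-boundary geodesics. -/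
theorem _root_.SurfaceCurrents.HyperbolicSurface.image_preimage_inter_not_isBoundary {T : Type*} [TopologicalSpace T]
    (h : HyperbolicSurface T) {k : SL(2, ℝ)} (hk : k ∈ h.deck) (s : Set (Geod h.cover)) :
    Geod.map k (h.smul_mem_cover hk) ''
      (Geod.map k (h.smul_mem_cover hk) ⁻¹' s ∩ {e | ¬ e.IsBoundary}) =
      s ∩ {e | ¬ e.IsBoundary} := by
  have hk' : k⁻¹ ∈ h.deck := h.deck.inv_mem hk
  have hcancel : ∀ (a b : SL(2, ℝ)) (ha : a ∈ h.deck) (hb : b ∈ h.deck), b * a = 1 →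
      ∀ e, Geod.map b (h.smul_mem_cover hb) (Geod.map a (h.smul_mem_cover ha) e) = e := by
    intro a b ha hb hab e
    rw [Geod.map_map _ _ _ _ (h.smul_mem_cover (h.deck.mul_mem hb ha)),
      Geod.map_congr _ (g' := 1) (fun z hz => by rwa [one_smul]) (fun x => by rw [hab])]
    apply Subtype.ext
    change Sym2.map (circleMap 1) e.1 = e.1
    have : circleMap 1 = id := funext fun x => by simp [circleMap]
    rw [this, Sym2.map_id, id]
  ext e
  constructor
  · rintro ⟨e, ⟨h1, h2⟩, rfl⟩
    refine ⟨h1, fun hb => h2 ?_⟩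
    have := Geod.IsBoundary.map hk'.1 hb
    rwa [hcancel k k⁻¹ hk hk' (inv_mul_cancel k)] at this
  · rintro ⟨h1, h2⟩
    have he := hcancel k⁻¹ k hk' hk (mul_inv_cancel k) e
    refine ⟨_, ⟨?_, fun hb => h2 ?_⟩, he⟩
    · rw [mem_preimage, he]
      exact h1
    · have := Geod.IsBoundary.map hk.1 hb
      rwa [he] at this

/-- The part of a current of `S` that is carried by the interior geodesics of the component
`R i`. -/
def restrictCurrent (c : hS.Current) (i : ι) : (hR i).Current where
  measure := I.restrictMeasure c i
  isLocallyFinite := I.isLocallyFiniteMeasure_restrictMeasure c i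
  invariant k hk := by
    have hemb := Geod.measurableEmbedding_map k ((hR i).smul_mem_cover hk)
    refine Measure.ext fun s hs => ?_
    -- The action of `k` on the component becomes the action of its conjugate by the lift, a deck
    -- transformation of `S` that preserves `c`.
    rw [hemb.map_apply, I.restrictMeasure_apply c i (hemb.measurable hs),
      I.restrictMeasure_apply c i hs, ← (hR i).image_preimage_inter_not_isBoundary hk s,
      ← c.measure_image (I.conj_mem_deck hk), image_image, image_image]
    congr 1
    refine image_congr fun e _ => ?_
    have hm : ∀ z ∈ (hR i).cover, (I.lift i * k) • z ∈ hS.cover := fun z hz => by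
      rw [mul_smul]
      exact I.lift_mem i _ ((hR i).smul_mem_cover hk z hz)
    rw [Geod.map_map _ _ _ _ hm, Geod.map_map _ _ _ _ (by simpa using hm)]
    exact congrFun (Geod.map_congr _ _ fun x => by simp) e

theorem isInternal_restrictCurrent (c : hS.Current) (i : ι) :
    (I.restrictCurrent c i).IsInternal := by
  intro e he
  change I.restrictMeasure c i {e} = 0
  rw [I.restrictMeasure_apply c i (measurableSet_singleton e)]
  have : {e} ∩ {e : Geod (hR i).cover | ¬ e.IsBoundary} = ∅ := by
    rw [singleton_inter_eq_empty]
    exact not_not.2 he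
  rw [this, image_empty, measure_empty]

/-! ### Internal currents as the currents carried by the pieces -/

theorem measurableSet_piece (q : Σ i, hS.deck ⧸ I.imageDeck i) : MeasurableSet (I.piece q) :=
  (Geod.measurableEmbedding_map _ _).measurableSet_image.2
    (hR q.1).measurableSet_not_isBoundary

theorem measurableSet_iUnion_piece : MeasurableSet (⋃ q, I.piece q) :=
  have := I.countable_translates
  MeasurableSet.iUnion I.measurableSet_piece

/-- By invariance of `c` under the coset representatives, the term of index `q` is the `c`-mass of
`A` in the piece of `q`; disjointness lets these masses add up. -/
theorem push_restrictCurrent (c : hS.Current) {A : Set (Geod hS.cover)} (hA : MeasurableSet A) :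
    I.push (I.restrictCurrent c) A = c.measure (A ∩ ⋃ q, I.piece q) := by
  have := I.countable_translates
  rw [I.push_apply _ hA, inter_iUnion, measure_iUnion
    (fun q q' h => (I.pairwise_disjoint_piece h).mono inter_subset_right inter_subset_right)
    fun q => hA.inter (I.measurableSet_piece q)]
  refine tsum_congr fun q => ?_
  change I.restrictMeasure c q.1 _ = _
  rw [I.restrictMeasure_apply c q.1 ((Geod.measurableEmbedding_map _ _).measurable hA),
    ← c.measure_image q.2.out.2, image_image]
  have hmap : ∀ e, Geod.map (q.2.out : SL(2, ℝ)) (hS.smul_mem_cover q.2.out.2)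
      (Geod.map (I.lift q.1) (I.lift_mem q.1) e) =
        Geod.map (I.translate q) (I.translate_mem q) e :=
    fun e => Geod.map_map _ _ _ _ (I.translate_mem q) e
  simp only [hmap]
  rw [image_preimage_inter, piece]

theorem push_compl_iUnion_piece {c : ∀ i, (hR i).Current} (hc : ∀ i, (c i).IsInternal) :
    I.push c (⋃ q, I.piece q)ᶜ = 0 := by
  rw [I.push_apply c I.measurableSet_iUnion_piece.compl, ENNReal.tsum_eq_zero]
  intro q
  refine measure_mono_null (t := {e | e.IsBoundary}) (fun e he => ?_) ?_
  · by_contra hb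
    exact he (mem_iUnion.2 ⟨q, mem_image_of_mem _ hb⟩)
  · rw [← biUnion_of_singleton {e : Geod (hR q.1).cover | e.IsBoundary},
      measure_biUnion_null_iff (hR q.1).countable_isBoundary]
    exact hc q.1

theorem internalCurrents_eq :
    I.internalCurrents = {c : hS.Current | c.measure (⋃ q, I.piece q)ᶜ = 0} := by
  ext c
  constructor
  · rintro ⟨c', hc', hcc'⟩
    rw [mem_ofPred_eq, hcc', I.push_compl_iUnion_piece hc']
  · intro hc
    refine ⟨I.restrictCurrent c, I.isInternal_restrictCurrent c, Measure.ext fun A hA => ?_⟩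
    rw [I.push_restrictCurrent c hA, measure_inter_conull hc]

end GeodesicRealization

end SurfaceCurrents

end
open SurfaceCurrents in
theorem mainTheorem6 {S : Type*} [TopologicalSpace S] [CompactSpace S] [T2Space S]
    [ConnectedSpace S] (hS : HyperbolicSurface S)
    {ι : Type*} [Finite ι] {R : ι → Type*} [∀ i, TopologicalSpace (R i)]
    [∀ i, CompactSpace (R i)] [∀ i, T2Space (R i)] [∀ i, ConnectedSpace (R i)]
    (hR : ∀ i, HyperbolicSurface (R i)) (I : GeodesicRealization hS hR) :
    MeasurableSet I.internalCurrents := by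
  rw [I.internalCurrents_eq]
  exact hS.measurable_measure I.measurableSet_iUnion_piece.compl (measurableSet_singleton 0)
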